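/- Let $\mathfrak g=\mathfrak{spin}(3,1)_{\mathbb C}$ with generators $J_0,J_1,J_2$ (rotations) and $K_0,K_1,K_2$ (boosts), $[J_a,J_b]=i\varepsilon_{abc}J_c$, $[J_a,K_b]=i\varepsilon_{abc}K_c$, $[K_a,K_b]=-i\varepsilon_{abc}J_c$, put $J_\pm=J_1\pm iJ_2$, $K_\pm=K_1\pm iK_2$, and let $\mathcal C_1=\vec J\cdot\vec K$, $\mathcal C_2=J^2-K^2$ be its Casimirs. For $j\in\tfrac12\mathbb N_0$ let $\mathcal M_j=\{-j,-j+1,\dots,j\}$ and $C_\pm(j,m)=\sqrt{j\mp m}\sqrt{j\pm m+1}$. For $\lambda\in\tfrac12\mathbb Z$ and $\rho\in\mathbb C$ put $$P^-(j)=\frac{\sqrt{j+\lambda}\sqrt{j-\lambda}\sqrt{j+\rho}\sqrt{j-\rho}}{j\sqrt{2j+1}\sqrt{2j-1}},\qquad P^+(j)=P^-(j+1),\qquad P(j)=\frac{i\lambda\rho}{j(j+1)}\ (j\ne0),\quad P(0)=0.$$ The irreducible module $V_{\lambda,\rho}$ is the complex vector space with basis $|j,m\rangle$, where $m\in\mathcal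 M_j$ and $j$ runs over $|\lambda|,|\lambda|+1,\dots$, up to and including the first $j$ with $P^+(j)=0$ if there is one, and without bound otherwise. On it (vectors outside the range being $0$) $J_0|j,m\rangle=m|j,m\rangle$, $J_\pm|j,m\rangle=C_\pm(j,m)|j,m\pm1\rangle$, $$K_0|j,m\rangle=P^+(j)\sqrt{j+m+1}\sqrt{j-m+1}\,|j+1,m\rangle+P(j)\,m\,|j,m\rangle+P^-(j)\sqrt{j+m}\sqrt{j-m}\,|j-1,m\rangle,$$ $$K_\pm|j,m\rangle=\mp P^+(j)\sqrt{j\pm m+1}\sqrt{j\pm m+2}\,|j+1,m\pm1\rangle+P(j)C_\pm(j,m)|j,m\pm1\rangle\pm P^-(j)\sqrt{j\mp m}\sqrt{j\mp m-1}\,|j-1,m\pm1\rangle .$$ For $\gamma_1,\gamma_2\in\tfrac12\mathbb N_0$ let $(\gamma_1,\gamma_2)=F^-_{\gamma_1}\otimes F^+_{\gamma_2}$, where $F^{\pm}_\gamma$ is the $(2\gamma+1)$-dimensional space with basis $|\gamma,\mu\rangle$, $\mu\in\mathcal M_\gamma$, on which $J_0|\gamma,\mu\rangle=\mu|\gamma,\mu\rangle$,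 $J_\pm|\gamma,\mu\rangle=C_\pm(\gamma,\mu)|\gamma,\mu\pm1\rangle$, and $\vec K=\pm i\vec J$ on $F^\pm_\gamma$. On tensor products the generators act by $X\otimes1+1\otimes X$. Let $\gamma_1,\gamma_2\in\tfrac12\mathbb N_0$ with $\gamma_1,\gamma_2\ge\tfrac12$, and let $(\lambda,\rho)\in\tfrac12\mathbb Z\times\mathbb C$ be such that $V_{\lambda,\rho}$ is infinite-dimensional. Then: 1. The Casimirs are simultaneously diagonalisable on $(\gamma_1,\gamma_2)\otimes V_{\lambda,\rho}$ (that is, the space has a basis of common eigenvectors of $\mathcal C_1$ and $\mathcal C_2$) if and only if $$\rho-\lambda\notin(-2\gamma_1,2\gamma_1)\cap\mathbb Z\quad\text{and}\quad\rho+\lambda\notin(-2\gamma_2,2\gamma_2)\cap\mathbb Z.$$ 2. Whether or not they are simultaneously diagonalisable, the set of pairs of eigenvalues of $(\mathcal C_1,\mathcal C_2)$ on common eigenvectors in $(\gamma_1,\gamma_2)\otimes V_{\lambda,\rho}$ is exactly the set of the pairs $$\bigl(i\Lambda\mathrm P,\ \Lambda^2+\mathrm P^2-1\bigr),\qquad(\Lambda,\mathrm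 P)=(\lambda+\nu_1+\nu_2,\ \rho-\nu_1+\nu_2),\quad\nu_1\in\mathcal M_{\gamma_1},\ \nu_2\in\mathcal M_{\gamma_2}.$$ 3. In general the pairs in 2 need not be distinct: there are $\gamma_1,\gamma_2,\lambda,\rho$ as above for which two different $(\nu_1,\nu_2)\in\mathcal M_{\gamma_1}\times\mathcal M_{\gamma_2}$ give the same pair of eigenvalues. -/

import Mathlib

set_option maxSynthPendingDepth 3

open scoped TensorProduct

noncomputable section

namespace Lorentz

/-- The operators by which the generators `J₀, J₁, J₂` (rotations) and `K₀, K₁, K₂` (boosts) of the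
complexified Lorentz algebra act on a complex vector space. It is only a container: the actions
that are used are constructed explicitly below. -/
structure Action (V : Type) [AddCommGroup V] [Module ℂ V] where
  J : Fin 3 → Module.End ℂ V
  K : Fin 3 → Module.End ℂ V

section General

variable {V W : Type} [AddCommGroup V] [Module ℂ V] [AddCommGroup W] [Module ℂ W]

/-- From `X₀, X₊, X₋` with `X± = X₁ ± i X₂`, recover the triple `(X₀, X₁, X₂)`. -/
def ofLadder (X₀ Xp Xm : Module.End ℂ V) : Fin 3 → Module.End ℂ V :=
  ![X₀, (1 / 2 : ℂ) • (Xp + Xm), (1 / (2 * Complex.I)) • (Xp - Xm)]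

/-- The action on the tensor product, `J = J ⊗ 1 + 1 ⊗ J` and `K = K ⊗ 1 + 1 ⊗ K`. -/
def Action.tensor (A : Action V) (B : Action W) : Action (V ⊗[ℂ] W) where
  J a := (A.J a).rTensor W + (B.J a).lTensor V
  K a := (A.K a).rTensor W + (B.K a).lTensor V

/-- The Casimir `C₁ = J · K`. -/
def Action.casimir₁ (A : Action V) : Module.End ℂ V := ∑ a, A.J a * A.K a

/-- The Casimir `C₂ = J² - K²`. -/
def Action.casimir₂ (A : Action V) : Module.End ℂ V :=
  ∑ a, A.J a * A.J a - ∑ a, A.K a * A.K a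

/-- `v` is a common eigenvector-or-zero of `S` and `T`, with the pair of eigenvalues `c`. -/
def IsJointEigen (S T : Module.End ℂ V) (c : ℂ × ℂ) (v : V) : Prop :=
  S v = c.1 • v ∧ T v = c.2 • v

/-- There is a basis of the space that consists of common eigenvectors of `S` and `T`. -/
def SimultaneouslyDiagonalisable (S T : Module.End ℂ V) : Prop :=
  ∃ (ι : Type) (b : Module.Basis ι ℂ V), ∀ i, ∃ c : ℂ × ℂ, IsJointEigen S T c (b i)

/-- The set of pairs of eigenvalues of `S` and `T` on common (nonzero) eigenvectors. -/
def jointEigenvalues (S T : Module.End ℂ V) : Set (ℂ × ℂ) :=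
  {c | ∃ v : V, v ≠ 0 ∧ IsJointEigen S T c v}

end General

/-- The set `M_j = {-j, -j+1, …, j-1, j}`. -/
def magnetic (j : ℚ) : Set ℚ := {m | ∃ n : ℕ, m = -j + n ∧ m ≤ j}

/-- `√q` as a complex number, for a rational `q ≥ 0`. -/
def rsqrt (q : ℚ) : ℂ := (Real.sqrt (q : ℝ) : ℂ)

/-- `C₊(j,m) = √(j-m) √(j+m+1)`. -/
def Cp (j m : ℚ) : ℂ := rsqrt (j - m) * rsqrt (j + m + 1)

/-- `C₋(j,m) = √(j+m) √(j-m+1)`. -/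
def Cm (j m : ℚ) : ℂ := rsqrt (j + m) * rsqrt (j - m + 1)

/-! ### The finite-dimensional modules -/

/-- The space with basis `|γ,μ⟩`, `μ ∈ M_γ`. -/
abbrev SpinSpace (γ : ℚ) : Type := magnetic γ →₀ ℂ

open Classical in
/-- The vector `|γ,μ⟩`, with the convention that it is `0` when `μ ∉ M_γ`. -/
def spinKet (γ μ : ℚ) : SpinSpace γ :=
  if h : μ ∈ magnetic γ then Finsupp.single ⟨μ, h⟩ 1 else 0

/-- The irreducible spin-`γ` operators:
`J₀|γ,μ⟩ = μ|γ,μ⟩` and `J±|γ,μ⟩ = C±(γ,μ)|γ,μ±1⟩`. -/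
def spinJ (γ : ℚ) : Fin 3 → Module.End ℂ (SpinSpace γ) :=
  ofLadder
    (Finsupp.linearCombination ℂ fun μ : magnetic γ => ((μ : ℚ) : ℂ) • spinKet γ μ)
    (Finsupp.linearCombination ℂ fun μ : magnetic γ => Cp γ μ • spinKet γ (μ + 1))
    (Finsupp.linearCombination ℂ fun μ : magnetic γ => Cm γ μ • spinKet γ (μ - 1))

/-- The left module `F⁻_γ = (γ,0)`, on which `K = -i J`. -/
def leftAction (γ : ℚ) : Action (SpinSpace γ) where
  J := spinJ γ
  K a := (-Complex.I) • spinJ γ a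

/-- The right module `F⁺_γ = (0,γ)`, on which `K = i J`. -/
def rightAction (γ : ℚ) : Action (SpinSpace γ) where
  J := spinJ γ
  K a := Complex.I • spinJ γ a

/-- The finite-dimensional module `(γ₁,γ₂) = (γ₁,0) ⊗ (0,γ₂)`. -/
def finiteAction (γ₁ γ₂ : ℚ) : Action (SpinSpace γ₁ ⊗[ℂ] SpinSpace γ₂) :=
  (leftAction γ₁).tensor (rightAction γ₂)

/-! ### The irreducible modules `V_{λ,ρ}` (here `l` stands for `λ`) -/

/-- `P⁻_{λ,ρ}(j) = √(j+λ) √(j-λ) √(j+ρ) √(j-ρ) / (j √(2j+1) √(2j-1))`. -/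
def Pminus (l : ℚ) (ρ : ℂ) (j : ℚ) : ℂ :=
  rsqrt (j + l) * rsqrt (j - l) * Complex.sqrt ((j : ℂ) + ρ) * Complex.sqrt ((j : ℂ) - ρ) /
    ((j : ℂ) * rsqrt (2 * j + 1) * rsqrt (2 * j - 1))

/-- `P⁺_{λ,ρ}(j) = P⁻_{λ,ρ}(j+1)`. -/
def Pplus (l : ℚ) (ρ : ℂ) (j : ℚ) : ℂ := Pminus l ρ (j + 1)

/-- `P_{λ,ρ}(j) = i λ ρ / (j (j+1))`, and `0` for `j = 0`. -/
def Pzero (l : ℚ) (ρ : ℂ) (j : ℚ) : ℂ :=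
  if j = 0 then 0 else Complex.I * (l : ℂ) * ρ / ((j : ℂ) * ((j : ℂ) + 1))

/-- The spins that occur in `V_{λ,ρ}`: `j = |λ|, |λ|+1, …`, up to and including the first one with
`P⁺_{λ,ρ}(j) = 0` if there is one, and without upper bound otherwise. -/
def spins (l : ℚ) (ρ : ℂ) : Set ℚ :=
  {j | ∃ n : ℕ, j = |l| + n ∧ ∀ k : ℕ, k < n → Pplus l ρ (|l| + k) ≠ 0}

/-- The labels `(j,m)` of the basis vectors `|(λ,ρ) j,m⟩`. -/
abbrev Labels (l : ℚ) (ρ : ℂ) : Type := {p : ℚ × ℚ // p.1 ∈ spins l ρ ∧ p.2 ∈ magnetic p.1}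

/-- The space underlying `V_{λ,ρ}`: finite linear combinations of the `|(λ,ρ) j,m⟩`. -/
abbrev Space (l : ℚ) (ρ : ℂ) : Type := Labels l ρ →₀ ℂ

section Irreducible

variable (l : ℚ) (ρ : ℂ)

open Classical in
/-- The vector `|(λ,ρ) j,m⟩`, with the convention that it is `0` when `(j,m)` is not a label. -/
def ket (j m : ℚ) : Space l ρ :=
  if h : j ∈ spins l ρ ∧ m ∈ magnetic j then Finsupp.single ⟨(j, m), h⟩ 1 else 0

/-- The linear operator with prescribed values on the basis vectors `|(λ,ρ) j,m⟩`. -/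
def onBasis (f : ℚ → ℚ → Space l ρ) : Module.End ℂ (Space l ρ) :=
  Finsupp.linearCombination ℂ fun p : Labels l ρ => f p.1.1 p.1.2

def J₀ : Module.End ℂ (Space l ρ) := onBasis l ρ fun j m => (m : ℂ) • ket l ρ j m

def Jplus : Module.End ℂ (Space l ρ) := onBasis l ρ fun j m => Cp j m • ket l ρ j (m + 1)

def Jminus : Module.End ℂ (Space l ρ) := onBasis l ρ fun j m => Cm j m • ket l ρ j (m - 1)

def K₀ : Module.End ℂ (Space l ρ) := onBasis l ρ fun j m =>
  (Pplus l ρ j * rsqrt (j + m + 1) * rsqrt (j - m + 1)) • ket l ρ (j + 1) m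
    + (Pzero l ρ j * (m : ℂ)) • ket l ρ j m
    + (Pminus l ρ j * rsqrt (j + m) * rsqrt (j - m)) • ket l ρ (j - 1) m

def Kplus : Module.End ℂ (Space l ρ) := onBasis l ρ fun j m =>
  (-(Pplus l ρ j * rsqrt (j + m + 1) * rsqrt (j + m + 2))) • ket l ρ (j + 1) (m + 1)
    + (Pzero l ρ j * Cp j m) • ket l ρ j (m + 1)
    + (Pminus l ρ j * rsqrt (j - m) * rsqrt (j - m - 1)) • ket l ρ (j - 1) (m + 1)

def Kminus : Module.End ℂ (Space l ρ) := onBasis l ρ fun j m =>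
  (Pplus l ρ j * rsqrt (j - m + 1) * rsqrt (j - m + 2)) • ket l ρ (j + 1) (m - 1)
    + (Pzero l ρ j * Cm j m) • ket l ρ j (m - 1)
    + (-(Pminus l ρ j * rsqrt (j + m) * rsqrt (j + m - 1))) • ket l ρ (j - 1) (m - 1)

/-- The irreducible module `V_{λ,ρ}`. -/
def irrAction : Action (Space l ρ) where
  J := ofLadder (J₀ l ρ) (Jplus l ρ) (Jminus l ρ)
  K := ofLadder (K₀ l ρ) (Kplus l ρ) (Kminus l ρ)

end Irreducible

/-- The module `(γ₁,γ₂) ⊗ V_{λ,ρ}`. -/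
def productAction (γ₁ γ₂ l : ℚ) (ρ : ℂ) :
    Action ((SpinSpace γ₁ ⊗[ℂ] SpinSpace γ₂) ⊗[ℂ] Space l ρ) :=
  (finiteAction γ₁ γ₂).tensor (irrAction l ρ)

/-- The pair of values of `(C₁, C₂)` with label `(Λ,Ρ)`, namely `(i Λ Ρ, Λ² + Ρ² - 1)`. -/
def casimirPair (L P : ℂ) : ℂ × ℂ := (Complex.I * L * P, L ^ 2 + P ^ 2 - 1)

/-- The pair of Casimir values with label `(Λ,Ρ) = (λ + ν₁ + ν₂, ρ - ν₁ + ν₂)`. -/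
def shiftedPair (l : ℚ) (ρ : ℂ) (ν : ℚ × ℚ) : ℂ × ℂ :=
  casimirPair ((l : ℂ) + (ν.1 : ℂ) + (ν.2 : ℂ)) (ρ - (ν.1 : ℂ) + (ν.2 : ℂ))

/-- The set `(-a, a) ∩ ℤ`, in `ℂ`. -/
def integersWithin (a : ℚ) : Set ℂ := {z | ∃ n : ℤ, z = (n : ℂ) ∧ -a < (n : ℚ) ∧ (n : ℚ) < a}

end Lorentz

end

/-! The combinations `(J + iK)/2` and `(J - iK)/2` are two commuting copies of `sl₂`. On `F⁻` only
the first acts and on `F⁺` only the second, so the product module carries two commuting triples: the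
spin of `F⁻` plus the first copy on `V`, and the spin of `F⁺` plus the second copy on `V`. If `A`
and `B` are the Casimirs of these triples, then `C₁ = -i(A - B)` and `C₂ = 2(A + B)`, so the common
eigenvectors of `C₁, C₂` are those of `A, B`. On `V` itself the two copies have the scalar Casimirs
`((λ ∓ ρ)² - 1)/4`.

The problem thus reduces to a spin-`n/2` module tensored with any module of scalar Casimir `(a² -
1)/4`. There the total Casimir is annihilated by the product of the `n + 1` factors `x - ((a + n -
2k)² - 1)/4`, `0 ≤ k ≤ n` (`Triple.Coupled.aeval_levelPoly`). The proof applies the factors one at a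
time to a lowest weight vector of the spin module and follows the result in closed form
(`omega_residual`) until it vanishes (`residual_top`).

No factor can be spared: up to lower terms, `m` factors send a lowest weight vector `y` to `e^m f^m
y`, with `e` from the spin and `f` from the other module (`prod_ne_zero`). On an
infinite-dimensional `V` the lowering operators of both copies carry the vector `m = -j` of spin `j`
to a nonzero multiple of the one of spin `j + 1`, forever. So even the product of the two
polynomials, each short of one factor, is nonzero (`omitted_factor_ne_zero`).

Linear algebra concludes. Every pair of roots is a pair of eigenvalues (`jointEigenvalues_eq`), and
`A, B` are simultaneously diagonalisable exactly when neither list of roots has a repetition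
(`simultaneouslyDiagonalisable_iff_injOn`). Roots `k ≠ m` coincide iff `a = k + m - n`, which for
some such pair means `a ∈ (-n, n) ∩ ℤ` (`level_injOn_iff`). -/

noncomputable section

namespace Lorentz

open Polynomial

/-! ### Triples of `sl₂` in a ring and their Casimirs. -/

/-- Three elements `h, e, f` of a ring, meant to satisfy the relations of `sl₂`. -/
structure Triple (A : Type*) where
  h : A
  e : A
  f : A

/-- Regroups the image under a tridiagonal operator by the index where each term lands: `d i` stays
at `i`, `u i` moves to `i + 1`, `l i` to `i - 1`. The vanishing hypotheses dispose of the terms at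
the two ends. -/
theorem sum_tridiagonal {U : Type*} [AddCommGroup U] (k : ℕ) (d u l t : ℕ → U)
    (hd : d (k + 2) = 0) (hu : u (k + 1) = 0) (hu' : u (k + 2) = 0) (hl : l 0 = 0)
    (h0 : t 0 = d 0 + l 1) (hs : ∀ i ≤ k, t (i + 1) = d (i + 1) + u i + l (i + 2)) :
    ∑ i ∈ Finset.range (k + 3), (d i + u i + l i) = ∑ i ∈ Finset.range (k + 2), t i := by
  rw [Finset.sum_range_succ' t, Finset.sum_congr rfl fun i hi =>
    hs i (Nat.lt_succ_iff.mp (Finset.mem_range.mp hi)), h0]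
  simp only [Finset.sum_add_distrib]
  rw [Finset.sum_range_succ d, hd, Finset.sum_range_succ' d, Finset.sum_range_succ u, hu',
    Finset.sum_range_succ u, hu, Finset.sum_range_succ' l, hl, Finset.sum_range_succ' _ (k + 1)]
  abel

namespace Triple

section Ring

variable {A : Type*} [Ring A]

/-- The relations `[h, e] = e`, `[h, f] = -f`, `[e, f] = 2h`. -/
structure IsSl2 (T : Triple A) : Prop where
  he : T.h * T.e = T.e * T.h + T.e
  hf : T.h * T.f = T.f * T.h - T.f
  ef : T.e * T.f = T.f * T.e + 2 * T.h

/-- Every entry of `S` commutes with every entry of `T`. -/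
structure Commutes (S T : Triple A) : Prop where
  hh : S.h * T.h = T.h * S.h
  he : S.h * T.e = T.e * S.h
  hf : S.h * T.f = T.f * S.h
  eh : S.e * T.h = T.h * S.e
  ee : S.e * T.e = T.e * S.e
  ef : S.e * T.f = T.f * S.e
  fh : S.f * T.h = T.h * S.f
  fe : S.f * T.e = T.e * S.f
  ff : S.f * T.f = T.f * S.f

/-- The sum of two triples, entry by entry. -/
def add (S T : Triple A) : Triple A := ⟨S.h + T.h, S.e + T.e, S.f + T.f⟩

/-- The quadratic Casimir `h² + h + fe`. -/
def casimir (T : Triple A) : A := T.h * T.h + T.h + T.f * T.e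

theorem Commutes.symm {S T : Triple A} (h : Commutes S T) : Commutes T S :=
  ⟨h.hh.symm, h.eh.symm, h.fh.symm, h.he.symm, h.ee.symm, h.fe.symm, h.hf.symm, h.ef.symm,
    h.ff.symm⟩

theorem Commutes.add_right {S T U : Triple A} (h : Commutes S T) (h' : Commutes S U) :
    Commutes S (T.add U) := by
  constructor <;> simp only [add, mul_add, add_mul, h.hh, h.he, h.hf, h.eh, h.ee, h.ef, h.fh, h.fe,
    h.ff, h'.hh, h'.he, h'.hf, h'.eh, h'.ee, h'.ef, h'.fh, h'.fe, h'.ff]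

theorem Commutes.add_left {S T U : Triple A} (h : Commutes S U) (h' : Commutes T U) :
    Commutes (S.add T) U :=
  (h.symm.add_right h'.symm).symm

theorem IsSl2.add {S T : Triple A} (hS : IsSl2 S) (hT : IsSl2 T) (h : Commutes S T) :
    IsSl2 (S.add T) := by
  constructor
  · simp only [Triple.add, mul_add, add_mul, hS.he, hT.he, h.he, h.eh]; abel
  · simp only [Triple.add, mul_add, add_mul, hS.hf, hT.hf, h.hf, h.fh]; abel
  · simp only [Triple.add, mul_add, add_mul, hS.ef, hT.ef, h.ef, h.fe]; abel

theorem casimir_add {S T : Triple A} (h : Commutes S T) :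
    (S.add T).casimir = S.casimir + T.casimir + 2 * (S.h * T.h) + S.f * T.e + S.e * T.f := by
  simp only [add, casimir, mul_add, add_mul, ← h.hh, ← h.ef, two_mul]; abel

theorem Commutes.commute_casimir {S T : Triple A} (h : Commutes S T) :
    Commute S.casimir T.casimir := by
  have hh : Commute S.h T.h := h.hh
  have he : Commute S.h T.e := h.he
  have hf : Commute S.h T.f := h.hf
  have eh : Commute S.e T.h := h.eh
  have ee : Commute S.e T.e := h.ee
  have ef : Commute S.e T.f := h.ef
  have fh : Commute S.f T.h := h.fh
  have fe : Commute S.f T.e := h.fe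
  have ff : Commute S.f T.f := h.ff
  have key : ∀ x : A, Commute x T.h → Commute x T.e → Commute x T.f → Commute x T.casimir :=
    fun x h1 h2 h3 => ((h1.mul_right h1).add_right h1).add_right (h3.mul_right h2)
  exact (((key _ hh he hf).mul_left (key _ hh he hf)).add_left (key _ hh he hf)).add_left
    ((key _ fh fe ff).mul_left (key _ eh ee ef))

theorem Commutes.casimir_commute {S T : Triple A} (h : Commutes S T) :
    Commute S.casimir T.h ∧ Commute S.casimir T.e ∧ Commute S.casimir T.f := by
  have key : ∀ x : A, Commute S.h x → Commute S.e x → Commute S.f x → Commute S.casimir x :=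
    fun x h1 h2 h3 => ((h1.mul_left h1).add_left h1).add_left (h3.mul_left h2)
  exact ⟨key _ h.hh h.eh h.fh, key _ h.he h.ee h.fe, key _ h.hf h.ef h.ff⟩

theorem IsSl2.casimir_commute_e {T : Triple A} (h : IsSl2 T) : Commute T.casimir T.e := by
  change T.casimir * T.e = T.e * T.casimir
  have e1 : T.h * T.h * T.e = T.e * T.h * T.h + 2 * (T.e * T.h) + T.e := by
    rw [mul_assoc, h.he, mul_add, ← mul_assoc, h.he]; noncomm_ring
  have e2 : T.e * (T.f * T.e) = T.f * T.e * T.e + 2 * (T.e * T.h) + 2 * T.e := by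
    rw [← mul_assoc, h.ef, add_mul, mul_assoc 2, h.he]; noncomm_ring
  simp only [casimir, mul_add, add_mul, e1, e2, h.he]
  noncomm_ring

theorem IsSl2.e_mul_f {T : Triple A} (h : IsSl2 T) :
    T.e * T.f = T.casimir - T.h * T.h + T.h := by
  rw [h.ef, casimir]; noncomm_ring

end Ring

theorem commute_aeval {A : Type*} [Ring A] [Algebra ℂ A] {x z : A} (h : Commute x z) (p : ℂ[X]) :
    Commute (aeval x p) z := by
  induction p using Polynomial.induction_on' with
  | add p q hp hq => rw [map_add]; exact hp.add_left hq
  | monomial k c =>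
    rw [aeval_monomial]
    exact (Algebra.commute_algebraMap_left c z).mul_left (h.pow_left k)

/-! ### Tensoring with a spin-`n/2` module: the characteristic identity of the Casimir. -/

section Module

variable {U : Type*} [AddCommGroup U] [Module ℂ U]

/-- `y` is a lowest weight vector, of weight `-n/2`. -/
def Low (S : Triple (Module.End ℂ U)) (n : ℕ) (y : U) : Prop :=
  S.f y = 0 ∧ S.h y = (-(n : ℂ) / 2) • y

/-- The setting of the tensor product of a spin-`n/2` module, on which `S` acts, and of a module
with Casimir `(a² - 1) / 4`, on which `T` acts. -/
structure Coupled (n : ℕ) (a : ℂ) (S T : Triple (Module.End ℂ U)) : Prop where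
  left : IsSl2 S
  right : IsSl2 T
  comm : Commutes S T
  cas : T.casimir = ((a ^ 2 - 1) / 4) • 1
  top : ∀ y, Low S n y → (S.e ^ (n + 1)) y = 0
  span : ∀ W : Submodule ℂ U, (∀ y i, Low S n y → (S.e ^ i) y ∈ W) → W = ⊤

variable {S T : Triple (Module.End ℂ U)} {n : ℕ} {a : ℂ}

theorem IsSl2.h_e_pow (h : IsSl2 S) {y : U} (hy : Low S n y) (i : ℕ) :
    S.h ((S.e ^ i) y) = ((i : ℂ) - n / 2) • (S.e ^ i) y := by
  induction i with
  | zero => simp [hy.2, neg_div]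
  | succ i ih =>
    have := congrArg (fun g : Module.End ℂ U => g ((S.e ^ i) y)) h.he
    simp only [Module.End.mul_apply, LinearMap.add_apply] at this
    rw [pow_succ', Module.End.mul_apply, this, ih, map_smul]
    push_cast; module

theorem IsSl2.f_e_pow_succ (h : IsSl2 S) {y : U} (hy : Low S n y) (i : ℕ) :
    S.f ((S.e ^ (i + 1)) y) = (((i : ℂ) + 1) * (n - i)) • (S.e ^ i) y := by
  have key : ∀ z, S.f (S.e z) = S.e (S.f z) - (2 : ℂ) • S.h z := fun z => by
    have := congrArg (fun g : Module.End ℂ U => g z) h.ef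
    simp only [Module.End.mul_apply, LinearMap.add_apply, two_mul] at this
    rw [this]; module
  induction i with
  | zero => simp [key, hy.1, hy.2]; module
  | succ i ih =>
    rw [pow_succ', Module.End.mul_apply, key, ih, map_smul, ← Module.End.mul_apply, ← pow_succ',
      h.h_e_pow hy]
    push_cast; module

/-- At `i = 0` the truncated exponent `i - 1` is harmless, because the factor `i` vanishes. -/
theorem IsSl2.f_e_pow (h : IsSl2 S) {y : U} (hy : Low S n y) (i : ℕ) :
    S.f ((S.e ^ i) y) = ((i : ℂ) * (n - i + 1)) • (S.e ^ (i - 1)) y := by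
  cases i with
  | zero => simp [hy.1]
  | succ i => rw [h.f_e_pow_succ hy, Nat.add_sub_cancel]; push_cast; congr 1; ring

theorem IsSl2.casimir_e_pow (h : IsSl2 S) {y : U} (hy : Low S n y) (i : ℕ) :
    S.casimir ((S.e ^ i) y) = ((n : ℂ) * (n + 2) / 4) • (S.e ^ i) y := by
  have : S.f (S.e ((S.e ^ i) y)) = (((i : ℂ) + 1) * (n - i)) • (S.e ^ i) y := by
    rw [← Module.End.mul_apply S.e, ← pow_succ', h.f_e_pow_succ hy]
  simp only [casimir, LinearMap.add_apply, Module.End.mul_apply, this, h.h_e_pow hy, map_smul]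
  module

theorem IsSl2.h_f_pow (h : IsSl2 T) (i : ℕ) :
    T.h * T.f ^ i = T.f ^ i * (T.h - (i : ℂ) • 1) := by
  induction i with
  | zero => simp
  | succ i ih =>
    rw [pow_succ, ← mul_assoc, ih, mul_assoc, mul_assoc]
    congr 1
    rw [sub_mul, h.hf]; push_cast
    simp only [mul_sub, smul_mul_assoc, mul_smul_comm, one_mul, mul_one]; module

/-- Since `ef` is the Casimir minus `h² - h` and the Casimir is scalar, `e` cancels one `f` at the
price of a quadratic polynomial in `h`. This is why polynomials in `T.h` suffice as coefficients
below. -/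
theorem IsSl2.e_f_pow_succ (h : IsSl2 T) {c : ℂ} (hc : T.casimir = c • 1) (i : ℕ) :
    T.e * T.f ^ (i + 1) = T.f ^ i *
      (c • 1 - (T.h - (i : ℂ) • 1) * (T.h - (i : ℂ) • 1) + (T.h - (i : ℂ) • 1)) := by
  rw [pow_succ', ← mul_assoc, h.e_mul_f, hc, add_mul, sub_mul, mul_assoc, h.h_f_pow, ← mul_assoc,
    h.h_f_pow]
  simp only [mul_add, mul_sub, sub_mul, smul_mul_assoc, mul_smul_comm, one_mul, mul_one, mul_assoc]

/-- The vectors `eⁱ fⁱ g(h) y`, with `e` from `S` and `f`, `h` from `T`. -/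
def ladder (S T : Triple (Module.End ℂ U)) (y : U) (i : ℕ) : ℂ[X] →ₗ[ℂ] U :=
  (S.e ^ i * T.f ^ i) ∘ₗ (LinearMap.applyₗ y) ∘ₗ (aeval T.h).toLinearMap

theorem ladder_apply (y : U) (i : ℕ) (g : ℂ[X]) :
    ladder S T y i g = (S.e ^ i) ((T.f ^ i) (aeval T.h g y)) := rfl

namespace Coupled

variable (H : Coupled n a S T)
include H

/-- `T` commutes with `S`, so it acts on the space of lowest weight vectors of `S`, the multiplicity
space of the spin module. -/
theorem low_h {y : U} (hy : Low S n y) : Low S n (T.h y) := by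
  constructor
  · rw [← Module.End.mul_apply, H.comm.fh, Module.End.mul_apply, hy.1, map_zero]
  · rw [← Module.End.mul_apply, H.comm.hh, Module.End.mul_apply, hy.2, map_smul]

theorem low_e {y : U} (hy : Low S n y) : Low S n (T.e y) := by
  constructor
  · rw [← Module.End.mul_apply, H.comm.fe, Module.End.mul_apply, hy.1, map_zero]
  · rw [← Module.End.mul_apply, H.comm.he, Module.End.mul_apply, hy.2, map_smul]

theorem low_f {y : U} (hy : Low S n y) : Low S n (T.f y) := by
  constructor
  · rw [← Module.End.mul_apply, H.comm.ff, Module.End.mul_apply, hy.1, map_zero]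
  · rw [← Module.End.mul_apply, H.comm.hf, Module.End.mul_apply, hy.2, map_smul]

omit H in
theorem low_smul {y : U} (hy : Low S n y) (c : ℂ) : Low S n (c • y) := by
  constructor
  · rw [map_smul, hy.1, smul_zero]
  · rw [map_smul, hy.2, smul_comm]

omit H in
theorem low_add {y z : U} (hy : Low S n y) (hz : Low S n z) : Low S n (y + z) := by
  constructor
  · rw [map_add, hy.1, hz.1, add_zero]
  · rw [map_add, hy.2, hz.2, smul_add]

theorem low_f_pow {y : U} (hy : Low S n y) (i : ℕ) : Low S n ((T.f ^ i) y) := by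
  induction i with
  | zero => simpa using hy
  | succ i ih => rw [pow_succ', Module.End.mul_apply]; exact H.low_f ih

theorem low_aeval {y : U} (hy : Low S n y) (g : ℂ[X]) : Low S n (aeval T.h g y) := by
  induction g using Polynomial.induction_on' with
  | add p q hp hq => rw [map_add, LinearMap.add_apply]; exact low_add hp hq
  | monomial k c =>
    rw [aeval_monomial, Module.End.mul_apply, Module.algebraMap_end_apply]
    refine low_smul ?_ c
    induction k with
    | zero => simpa using hy
    | succ k ih => rw [pow_succ', Module.End.mul_apply]; exact H.low_h ih

/-- Only the cross terms `2 S.h T.h + S.f T.e + S.e T.f` of the Casimir of a sum mix the two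
factors, and the last two change the power of `S.e` by one. -/
theorem omega_e_pow {y : U} (hy : Low S n y) (i : ℕ) :
    (S.add T).casimir ((S.e ^ i) y) =
      (S.e ^ i) (((n : ℂ) * (n + 2) / 4 + (a ^ 2 - 1) / 4) • y + (2 * (i : ℂ) - n) • T.h y)
      + (S.e ^ (i + 1)) (T.f y) + ((i : ℂ) * (n - i + 1)) • (S.e ^ (i - 1)) (T.e y) := by
  have c1 : ∀ z, T.f ((S.e ^ i) z) = (S.e ^ i) (T.f z) := fun z => by
    have : Commute S.e T.f := H.comm.ef
    rw [← Module.End.mul_apply, ← (this.pow_left i).eq, Module.End.mul_apply]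
  have c2 : ∀ z, T.h ((S.e ^ i) z) = (S.e ^ i) (T.h z) := fun z => by
    have : Commute S.e T.h := H.comm.eh
    rw [← Module.End.mul_apply, ← (this.pow_left i).eq, Module.End.mul_apply]
  have c3 : ∀ z, T.e ((S.e ^ i) z) = (S.e ^ i) (T.e z) := fun z => by
    have : Commute S.e T.e := H.comm.ee
    rw [← Module.End.mul_apply, ← (this.pow_left i).eq, Module.End.mul_apply]
  rw [casimir_add H.comm, H.cas]
  simp only [LinearMap.add_apply, Module.End.mul_apply, LinearMap.smul_apply, Module.End.one_apply,
    two_mul, c1, c2, c3, H.left.h_e_pow (H.low_h hy), H.left.f_e_pow (H.low_e hy),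
    H.left.casimir_e_pow hy, pow_succ' S.e i, map_add, map_smul]
  module

/-- The Casimir of the sum is tridiagonal in the vectors `ladder S T y i g`. -/
theorem omega_ladder {y : U} (hy : Low S n y) (i : ℕ) (g : ℂ[X]) :
    (S.add T).casimir (ladder S T y i g) =
      ladder S T y i ((C ((n : ℂ) * (n + 2) / 4 + (a ^ 2 - 1) / 4)
        + C (2 * (i : ℂ) - n) * (X - C (i : ℂ))) * g)
      + ladder S T y (i + 1) g
      + ladder S T y (i - 1) (C ((i : ℂ) * (n - i + 1))
          * (C (a / 2 + i - 1 / 2) - X) * (X + C ((a - 1) / 2 - i + 1)) * g) := by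
  rw [ladder_apply, H.omega_e_pow (H.low_f_pow (H.low_aeval hy g) i)]
  have e1 : ∀ z, T.h ((T.f ^ i) z) = (T.f ^ i) ((T.h - (i : ℂ) • 1) z) := fun z => by
    rw [← Module.End.mul_apply, H.right.h_f_pow, Module.End.mul_apply]
  congr 1
  · congr 1
    · rw [ladder_apply, e1]
      congr 1
      simp only [map_mul, map_add, map_sub, aeval_C, aeval_X, Algebra.algebraMap_eq_smul_one,
        Module.End.mul_apply, LinearMap.add_apply, LinearMap.sub_apply, LinearMap.smul_apply,
        Module.End.one_apply, map_smul]
      module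
    · rw [ladder_apply, pow_succ' T.f, Module.End.mul_apply]
  · cases i with
    | zero => simp
    | succ i =>
      rw [← Module.End.mul_apply T.e, H.right.e_f_pow_succ H.cas, ladder_apply, ← map_smul]
      simp only [Nat.add_sub_cancel, Module.End.mul_apply]
      rw [← map_smul]
      congr 2
      -- With `u = X - i`, the quadratic `(a² - 1)/4 - u² + u` splits as `((a + 1)/2 - u)(u + (a -
      -- 1)/2)`; the second factor is the one built into `residualCoeff`.
      have : (C (((i + 1 : ℕ) : ℂ) * (n - (i + 1 : ℕ) + 1)) * (C (a / 2 + (i + 1 : ℕ) - 1 / 2) - X)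
          * (X + C ((a - 1) / 2 - (i + 1 : ℕ) + 1)) * g : ℂ[X]) =
          C (((i + 1 : ℕ) : ℂ) * (n - (i + 1 : ℕ) + 1)) * (C ((a ^ 2 - 1) / 4)
            - (X - C (i : ℂ)) * (X - C (i : ℂ)) + (X - C (i : ℂ))) * g := by
        congr 1
        rw [mul_assoc]
        congr 1
        have e2 : (a ^ 2 - 1) / 4 = (a / 2 - 1 / 2) * (a / 2 + 1 / 2) := by ring
        have e3 : a / 2 + ((i + 1 : ℕ) : ℂ) - 1 / 2 = (a / 2 - 1 / 2) + i + 1 := by push_cast; ring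
        have e4 : (a - 1) / 2 - ((i + 1 : ℕ) : ℂ) + 1 = (a / 2 - 1 / 2) - i := by push_cast; ring
        have e5 : a / 2 + 1 / 2 = (a / 2 - 1 / 2) + 1 := by ring
        rw [e2, e3, e4, e5]
        simp only [C_mul, C_add, C_sub, C_1]
        ring
      rw [this]
      simp only [map_mul, map_add, map_sub, aeval_C, aeval_X, Algebra.algebraMap_eq_smul_one,
        Module.End.mul_apply, LinearMap.add_apply, LinearMap.sub_apply, LinearMap.smul_apply,
        Module.End.one_apply, map_smul]
      module

/-- The polynomial coefficients of `residual`. -/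
def residualCoeff (n : ℕ) (a : ℂ) (k i : ℕ) : ℂ[X] :=
  C ((-1) ^ i * (k.choose i : ℂ)) *
    ∏ j ∈ Finset.Ico i k, (C ((n : ℂ) - j) * (X + C ((a - 1) / 2 - j)))

/-- The eigenvalue `((a + n - 2k)² - 1) / 4` of the Casimir of the coupled representation. -/
def level (n : ℕ) (a : ℂ) (k : ℕ) : ℂ := ((a + n - 2 * k) ^ 2 - 1) / 4

/-- Up to sign, the vector obtained from `y` by applying the factors `Ω - level n a j`, `j < k`. -/
def residual (S T : Triple (Module.End ℂ U)) (n : ℕ) (a : ℂ) (k : ℕ) (y : U) : U :=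
  ∑ i ∈ Finset.range (k + 1), ladder S T y i (residualCoeff n a k i)

omit H in
theorem residualCoeff_eq_zero {k i : ℕ} (h : k < i) : residualCoeff n a k i = 0 := by
  simp [residualCoeff, Nat.choose_eq_zero_of_lt h]

omit H in
theorem eval_residualCoeff_bot {k i : ℕ} (h : i < k) (x : ℂ) :
    (residualCoeff n a k i).eval x = (-1) ^ i * (k.choose i : ℂ) *
      (((n : ℂ) - i) * (x + ((a - 1) / 2 - i))) *
        (∏ j ∈ Finset.Ico (i + 1) k, (C ((n : ℂ) - j) * (X + C ((a - 1) / 2 - j)))).eval x := by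
  rw [residualCoeff, Finset.prod_eq_prod_Ico_succ_bot h]
  simp only [eval_mul, eval_C, eval_add, eval_X]
  ring

omit H in
theorem residualCoeff_succ_top {k i : ℕ} (h : i ≤ k) (x : ℂ) :
    (k.choose i : ℂ) * (residualCoeff n a (k + 1) i).eval x =
      ((k + 1).choose i : ℂ) * ((residualCoeff n a k i).eval x *
        (((n : ℂ) - k) * (x + ((a - 1) / 2 - k)))) := by
  rw [residualCoeff, residualCoeff, Finset.prod_Ico_succ_top h]
  simp
  ring

-- The linear factor by which `Ω` lowers the index `i + 1` is the very factor with `j = i` that is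
-- missing from the product in `residualCoeff n a k (i + 1)`. Restoring it gives the coefficient at
-- `i`, up to the ratio of the binomials.
omit H in
theorem residualCoeff_lower (k i : ℕ) (x : ℂ) :
    ((i : ℂ) + 1) * (n - i) * (x + ((a - 1) / 2 - i)) * (residualCoeff n a k (i + 1)).eval x =
      -((k : ℂ) - i) * (residualCoeff n a k i).eval x := by
  rcases lt_trichotomy i k with h | rfl | h
  · rw [eval_residualCoeff_bot h, residualCoeff]
    have := congrArg (Nat.cast (R := ℂ)) (Nat.choose_succ_right_eq k i)
    push_cast [Nat.cast_sub h.le] at this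
    simp only [eval_mul, eval_C]
    linear_combination (-1) ^ (i + 1) * (n - i) * (x + ((a - 1) / 2 - i)) *
      (∏ j ∈ Finset.Ico (i + 1) k, (C ((n : ℂ) - j) * (X + C ((a - 1) / 2 - j)))).eval x * this
  · simp [residualCoeff_eq_zero]
  · simp [residualCoeff_eq_zero h, residualCoeff_eq_zero (h.trans (Nat.lt_succ_self i))]

-- The component at index `0` of `(Ω - level k) residual k = -residual (k + 1)`.
omit H in
theorem residualCoeff_rec_zero (k : ℕ) :
    (C ((n : ℂ) * (n + 2) / 4 + (a ^ 2 - 1) / 4) + C (2 * ((0 : ℕ) : ℂ) - n) * (X - C ((0 : ℕ) : ℂ)))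
        * residualCoeff n a k 0
      + C (((1 : ℕ) : ℂ) * (n - (1 : ℕ) + 1)) * (C (a / 2 + (1 : ℕ) - 1 / 2) - X)
        * (X + C ((a - 1) / 2 - (1 : ℕ) + 1)) * residualCoeff n a k 1
      = C (level n a k) * residualCoeff n a k 0 - residualCoeff n a (k + 1) 0 := by
  refine Polynomial.funext fun x => ?_
  have h1 := residualCoeff_lower (n := n) (a := a) k 0 x
  have h2 := residualCoeff_succ_top (n := n) (a := a) (Nat.zero_le k) x
  simp only [Nat.choose_zero_right, Nat.cast_zero, Nat.cast_one, zero_add] at h1 h2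
  simp only [eval_add, eval_sub, eval_mul, eval_C, eval_X, Nat.cast_zero, Nat.cast_one, level]
  linear_combination (a / 2 + 1 / 2 - x) * h1 + h2

-- The component at index `i + 1` of the same identity. Once the common product is split off, what
-- remains is Pascal's rule and the ratio of neighbouring binomials; at `i = k` only the new top
-- term is left.
omit H in
theorem residualCoeff_rec_succ {k i : ℕ} (hi : i ≤ k) :
    (C ((n : ℂ) * (n + 2) / 4 + (a ^ 2 - 1) / 4)
        + C (2 * ((i + 1 : ℕ) : ℂ) - n) * (X - C ((i + 1 : ℕ) : ℂ))) * residualCoeff n a k (i + 1)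
      + residualCoeff n a k i
      + C (((i + 2 : ℕ) : ℂ) * (n - (i + 2 : ℕ) + 1)) * (C (a / 2 + (i + 2 : ℕ) - 1 / 2) - X)
        * (X + C ((a - 1) / 2 - (i + 2 : ℕ) + 1)) * residualCoeff n a k (i + 2)
      = C (level n a k) * residualCoeff n a k (i + 1) - residualCoeff n a (k + 1) (i + 1) := by
  rcases hi.lt_or_eq with h | rfl
  · refine Polynomial.funext fun x => ?_
    have h1 := residualCoeff_lower (n := n) (a := a) k (i + 1) x
    have h2 := congrArg (Nat.cast (R := ℂ)) (Nat.choose_succ_right_eq k i)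
    have h3 := congrArg (Nat.cast (R := ℂ)) (Nat.choose_succ_succ k i)
    push_cast [Nat.cast_sub h.le] at h1 h2 h3
    simp only [eval_add, eval_sub, eval_mul, eval_C, eval_X, level, eval_residualCoeff_bot h]
    push_cast
    have h4 : (residualCoeff n a k (i + 1)).eval x = (-1) ^ (i + 1) * (k.choose (i + 1) : ℂ) *
        (∏ j ∈ Finset.Ico (i + 1) k, (C ((n : ℂ) - j) * (X + C ((a - 1) / 2 - j)))).eval x := by
      simp only [residualCoeff, eval_mul, eval_C]
    have h5 : (residualCoeff n a (k + 1) (i + 1)).eval x =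
        (-1) ^ (i + 1) * ((k.choose i : ℂ) + k.choose (i + 1)) *
        (∏ j ∈ Finset.Ico (i + 1) k, (C ((n : ℂ) - j) * (X + C ((a - 1) / 2 - j)))).eval x *
        (((n : ℂ) - k) * (x + ((a - 1) / 2 - k))) := by
      rw [residualCoeff, Finset.prod_Ico_succ_top h, ← h3]
      simp only [eval_mul, eval_C, eval_add, eval_X]
      ring
    rw [h5]
    rw [h4] at h1 ⊢
    generalize (∏ j ∈ Finset.Ico (i + 1) k,
      (C ((n : ℂ) - j) * (X + C ((a - 1) / 2 - j)))).eval x = B at *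
    linear_combination (a / 2 + i + 3 / 2 - x) * h1 -
      (-1) ^ i * (n + (x + (a - 1) / 2) - i - k) * B * h2
  · rw [residualCoeff_eq_zero (Nat.lt_succ_self i),
      residualCoeff_eq_zero (Nat.lt_succ_of_lt (Nat.lt_succ_self i))]
    simp [residualCoeff, pow_succ]

/-- The telescoping step: each further factor of the polynomial turns one closed form into the next,
up to sign. -/
theorem omega_residual {y : U} (hy : Low S n y) (k : ℕ) :
    (S.add T).casimir (residual S T n a k y) - level n a k • residual S T n a k y =
      -residual S T n a (k + 1) y := by
  have e1 : residual S T n a k y =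
      ∑ i ∈ Finset.range (k + 3), ladder S T y i (residualCoeff n a k i) := by
    rw [Finset.sum_range_succ, Finset.sum_range_succ,
      residualCoeff_eq_zero (Nat.lt_succ_self k),
      residualCoeff_eq_zero (Nat.lt_succ_of_lt (Nat.lt_succ_self k))]
    simp [residual]
  have e2 : level n a k • residual S T n a k y = ∑ i ∈ Finset.range (k + 1 + 1),
      ladder S T y i (C (level n a k) * residualCoeff n a k i) := by
    rw [Finset.sum_range_succ, residualCoeff_eq_zero (Nat.lt_succ_self k)]
    simp [residual, Finset.smul_sum, ← smul_eq_C_mul]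
  have e3 : (S.add T).casimir (residual S T n a k y) =
      ∑ i ∈ Finset.range (k + 1 + 1),
        ladder S T y i (C (level n a k) * residualCoeff n a k i - residualCoeff n a (k + 1) i) := by
    rw [e1, map_sum]
    simp only [H.omega_ladder hy]
    refine sum_tridiagonal k _ _ _ _ ?_ ?_ ?_ ?_ ?_ fun i hi => ?_
    · rw [residualCoeff_eq_zero (by omega), mul_zero, map_zero]
    · rw [residualCoeff_eq_zero (by omega), map_zero]
    · rw [residualCoeff_eq_zero (by omega), map_zero]
    · simp
    · rw [← residualCoeff_rec_zero k, map_add]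
    · rw [← residualCoeff_rec_succ hi, map_add, map_add]; rfl
  rw [e2, e3, ← Finset.sum_sub_distrib, residual, ← Finset.sum_neg_distrib]
  refine Finset.sum_congr rfl fun i _ => ?_
  rw [← map_sub, ← map_neg]
  congr 1
  ring

/-- For `i ≤ n` the coefficient contains the factor `n - j` at `j = n`, which is zero; the remaining
term carries `S.e ^ (n + 1)`, which kills lowest weight vectors. -/
theorem residual_top {y : U} (hy : Low S n y) : residual S T n a (n + 1) y = 0 := by
  refine Finset.sum_eq_zero fun i hi => ?_
  rcases Nat.lt_succ_iff_lt_or_eq.mp (Finset.mem_range.mp hi) with h | rfl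
  · have : residualCoeff n a (n + 1) i = 0 := by
      rw [residualCoeff, Finset.prod_eq_zero (i := n) (by simp; omega) (by simp), mul_zero]
    rw [this, map_zero]
  · rw [ladder_apply]
    exact H.top _ (H.low_f_pow (H.low_aeval hy _) _)

/-- The product of the factors `x - level n a k`, `k < m`. -/
def levelPoly (n : ℕ) (a : ℂ) (m : ℕ) : ℂ[X] := ∏ k ∈ Finset.range m, (X - C (level n a k))

theorem aeval_levelPoly_low {y : U} (hy : Low S n y) (m : ℕ) :
    aeval (S.add T).casimir (levelPoly n a m) y = (-1 : ℂ) ^ m • residual S T n a m y := by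
  induction m with
  | zero => simp [levelPoly, residual, residualCoeff, ladder_apply]
  | succ m ih =>
    rw [levelPoly, Finset.prod_range_succ, mul_comm, map_mul, Module.End.mul_apply]
    rw [levelPoly] at ih
    rw [ih, map_smul, map_sub, aeval_X, aeval_C, LinearMap.sub_apply,
      Module.algebraMap_end_apply, H.omega_residual hy, pow_succ]
    module

/-- The characteristic identity of the Casimir of the coupled representation. -/
theorem aeval_levelPoly : aeval (S.add T).casimir (levelPoly n a (n + 1)) = 0 := by
  have hc : Commute (aeval (S.add T).casimir (levelPoly n a (n + 1))) (S.e + T.e) :=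
    commute_aeval (H.left.add H.right H.comm).casimir_commute_e _
  have hz : ∀ y i, Low S n y →
      aeval (S.add T).casimir (levelPoly n a (n + 1)) ((S.e ^ i) y) = 0 := by
    intro y i
    induction i generalizing y with
    | zero =>
      intro hy
      rw [pow_zero, Module.End.one_apply, H.aeval_levelPoly_low hy, H.residual_top hy, smul_zero]
    | succ i ih =>
      intro hy
      -- The Casimir commutes with `S.e + T.e` but not with `S.e`; the correction `S.e ^ i (T.e y)`
      -- again starts from a lowest weight vector, which is why the induction is uniform in `y`.
      have e : (S.e ^ (i + 1)) y = (S.e + T.e) ((S.e ^ i) y) - (S.e ^ i) (T.e y) := by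
        have : Commute S.e T.e := H.comm.ee
        rw [LinearMap.add_apply, ← Module.End.mul_apply T.e, ← (this.pow_left i).eq, pow_succ']
        simp
      rw [e, map_sub, ih _ (H.low_e hy), ← Module.End.mul_apply, hc.eq, Module.End.mul_apply,
        ih _ hy, map_zero, sub_zero]
  have := H.span (LinearMap.ker (aeval (S.add T).casimir (levelPoly n a (n + 1)))) hz
  exact LinearMap.ker_eq_top.mp this

/-! ### Leading terms: products of at most `n` factors do not vanish. -/

omit H in
/-- The span of the vectors `eⁱ y` with `i < m` and `y` a lowest weight vector. -/
def below (S : Triple (Module.End ℂ U)) (n m : ℕ) : Submodule ℂ U :=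
  Submodule.span ℂ {z | ∃ i < m, ∃ y, Low S n y ∧ z = (S.e ^ i) y}

omit H in
theorem e_pow_mem_below {y : U} (hy : Low S n y) {i m : ℕ} (h : i < m) :
    (S.e ^ i) y ∈ below S n m :=
  Submodule.subset_span ⟨i, h, y, hy, rfl⟩

omit H in
theorem below_mono {m m' : ℕ} (h : m ≤ m') : below S n m ≤ below S n m' :=
  Submodule.span_mono fun _ ⟨i, hi, y, hy, e⟩ => ⟨i, hi.trans_le h, y, hy, e⟩

theorem omega_below (m : ℕ) {z : U} (hz : z ∈ below S n m) :
    (S.add T).casimir z ∈ below S n (m + 1) := by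
  have : below S n m ≤ (below S n (m + 1)).comap (S.add T).casimir := by
    refine Submodule.span_le.mpr ?_
    rintro _ ⟨i, hi, y, hy, rfl⟩
    change (S.add T).casimir _ ∈ below S n (m + 1)
    rw [H.omega_e_pow hy]
    refine Submodule.add_mem _ (Submodule.add_mem _ ?_ ?_) (Submodule.smul_mem _ _ ?_)
    · exact e_pow_mem_below (low_add (low_smul hy _) (low_smul (H.low_h hy) _)) (by omega)
    · exact e_pow_mem_below (H.low_f hy) (by omega)
    · exact e_pow_mem_below (H.low_e hy) (by omega)
  exact this hz

/-- Each factor raises the power of `S.e` by at most one, and the rise comes from `S.e T.f` alone.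
The leading term therefore does not depend on the constants `c j`. -/
theorem prod_sub_mem_below {y : U} (hy : Low S n y) (c : ℕ → ℂ) (s : Finset ℕ) :
    aeval (S.add T).casimir (∏ j ∈ s, (X - C (c j))) y - (S.e ^ s.card) ((T.f ^ s.card) y)
      ∈ below S n s.card := by
  induction s using Finset.induction_on with
  | empty => simp
  | insert j s hj ih =>
    rw [Finset.prod_insert hj, Finset.card_insert_of_notMem hj, map_mul, Module.End.mul_apply]
    set u := aeval (S.add T).casimir (∏ j ∈ s, (X - C (c j))) y with hu
    have hle := below_mono (S := S) (n := n) (Nat.le_succ s.card)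
    have hl := H.low_f_pow hy s.card
    have e1 : aeval (S.add T).casimir (X - C (c j)) u - (S.e ^ (s.card + 1)) ((T.f ^ (s.card + 1)) y)
        = (S.add T).casimir (u - (S.e ^ s.card) ((T.f ^ s.card) y))
          + ((S.add T).casimir ((S.e ^ s.card) ((T.f ^ s.card) y))
            - (S.e ^ (s.card + 1)) ((T.f ^ (s.card + 1)) y))
          - c j • (u - (S.e ^ s.card) ((T.f ^ s.card) y))
          - c j • ((S.e ^ s.card) ((T.f ^ s.card) y)) := by
      simp only [map_sub, aeval_X, aeval_C, LinearMap.sub_apply, Module.algebraMap_end_apply]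
      module
    rw [e1]
    refine Submodule.sub_mem _ (Submodule.sub_mem _ (Submodule.add_mem _ (H.omega_below _ ih) ?_)
      (Submodule.smul_mem _ _ (hle ih))) (Submodule.smul_mem _ _ (e_pow_mem_below hl (by omega)))
    rw [H.omega_e_pow hl, pow_succ' T.f, Module.End.mul_apply, add_right_comm, add_sub_cancel_right]
    refine Submodule.add_mem _ ?_ (Submodule.smul_mem _ _ ?_)
    · exact e_pow_mem_below (low_add (low_smul hl _) (low_smul (H.low_h hl) _)) (by omega)
    · exact e_pow_mem_below (H.low_e hl) (by omega)

theorem f_pow_below {m : ℕ} {z : U} (hz : z ∈ below S n m) : (S.f ^ m) z = 0 := by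
  have key : ∀ (y : U), Low S n y → ∀ m i, i < m → (S.f ^ m) ((S.e ^ i) y) = 0 := by
    intro y hy m
    induction m with
    | zero => intro i hi; omega
    | succ m ih =>
      intro i hi
      rw [pow_succ, Module.End.mul_apply]
      cases i with
      | zero => simp [hy.1]
      | succ i => rw [H.left.f_e_pow_succ hy, map_smul, ih i (by omega), smul_zero]
  have : below S n m ≤ LinearMap.ker (S.f ^ m) := by
    refine Submodule.span_le.mpr ?_
    rintro _ ⟨i, hi, y, hy, rfl⟩
    exact key y hy m i hi
  exact this hz

theorem f_pow_e_pow {y : U} (hy : Low S n y) (m : ℕ) :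
    (S.f ^ m) ((S.e ^ m) y) = (∏ i ∈ Finset.range m, (((i : ℂ) + 1) * (n - i))) • y := by
  induction m with
  | zero => simp
  | succ m ih =>
    rw [pow_succ, Module.End.mul_apply, H.left.f_e_pow_succ hy, map_smul, ih, smul_smul,
      Finset.prod_range_succ, mul_comm]

/-- `S.f ^ m` kills all the lower terms and brings the leading one back to the lowest weight, so it
reads off the leading coefficient. The scalar is nonzero as long as `m ≤ n`. -/
theorem f_pow_prod {y : U} (hy : Low S n y) (c : ℕ → ℂ) (s : Finset ℕ) :
    (S.f ^ s.card) (aeval (S.add T).casimir (∏ j ∈ s, (X - C (c j))) y) =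
      (∏ i ∈ Finset.range s.card, (((i : ℂ) + 1) * (n - i))) • (T.f ^ s.card) y := by
  have := H.f_pow_below (H.prod_sub_mem_below hy c s)
  rw [map_sub, H.f_pow_e_pow (H.low_f_pow hy _), sub_eq_zero] at this
  exact this

theorem prod_ne_zero {y : U} (hy : Low S n y) (c : ℕ → ℂ) {s : Finset ℕ} (hs : s.card ≤ n)
    (h : (T.f ^ s.card) y ≠ 0) : aeval (S.add T).casimir (∏ j ∈ s, (X - C (c j))) y ≠ 0 := by
  intro h0
  have := H.f_pow_prod hy c s
  rw [h0, map_zero, eq_comm, smul_eq_zero, or_iff_left h, Finset.prod_eq_zero_iff] at this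
  obtain ⟨i, hi, h1⟩ := this
  rw [Finset.mem_range] at hi
  rcases mul_eq_zero.mp h1 with h2 | h2
  · exact Nat.cast_add_one_ne_zero i h2
  · have : n = i := by exact_mod_cast sub_eq_zero.mp h2
    omega

end Coupled
end Module
end Triple

/-! ### Two commuting operators annihilated by split polynomials. -/

section Joint

variable {U : Type} [AddCommGroup U] [Module ℂ U]

theorem aeval_of_eigen {A : Module.End ℂ U} {x : ℂ} {v : U} (h : A v = x • v) (p : ℂ[X]) :
    aeval A p v = p.eval x • v := by
  induction p using Polynomial.induction_on' with
  | add p q hp hq => rw [map_add, LinearMap.add_apply, hp, hq, eval_add, add_smul]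
  | monomial k c =>
    rw [aeval_monomial, Module.End.mul_apply, Module.algebraMap_end_apply, eval_monomial, mul_smul]
    congr 1
    induction k with
    | zero => simp
    | succ k ih => rw [pow_succ', Module.End.mul_apply, ih, map_smul, h, smul_smul, pow_succ]

theorem eigen_mem_of_aeval_prod_eq_zero {A : Module.End ℂ U} {E : ℕ → ℂ} {s : Finset ℕ}
    (hA : aeval A (∏ k ∈ s, (X - C (E k))) = 0) {x : ℂ} {v : U} (hv : v ≠ 0) (h : A v = x • v) :
    ∃ k ∈ s, x = E k := by
  have := aeval_of_eigen h (∏ k ∈ s, (X - C (E k)))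
  rw [hA, LinearMap.zero_apply, eq_comm, smul_eq_zero, or_iff_left hv, eval_prod,
    Finset.prod_eq_zero_iff] at this
  obtain ⟨k, hk, hz⟩ := this
  exact ⟨k, hk, by simpa [sub_eq_zero] using hz⟩

theorem mul_aeval_erase {A : Module.End ℂ U} {E : ℕ → ℂ} {s : Finset ℕ}
    (hA : aeval A (∏ k ∈ s, (X - C (E k))) = 0) {k : ℕ} (hk : k ∈ s) :
    A * aeval A (∏ j ∈ s.erase k, (X - C (E j))) =
      E k • aeval A (∏ j ∈ s.erase k, (X - C (E j))) := by
  rw [← Finset.mul_prod_erase s _ hk, map_mul, map_sub, aeval_X, aeval_C, sub_mul,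
    sub_eq_zero] at hA
  rw [hA, Algebra.algebraMap_eq_smul_one, smul_mul_assoc, one_mul]

/-- On an eigenbasis a repeated root is needed only once: whichever root a basis vector belongs to,
its value is still among the remaining ones. -/
theorem aeval_erase_eq_zero_of_not_injOn {A : Module.End ℂ U} {E : ℕ → ℂ} {s : Finset ℕ}
    (hA : aeval A (∏ k ∈ s, (X - C (E k))) = 0) {ι : Type} (b : Module.Basis ι ℂ U)
    (hb : ∀ i, ∃ x : ℂ, A (b i) = x • b i) {k l : ℕ} (hl : l ∈ s) (hkl : k ≠ l)
    (hE : E k = E l) : aeval A (∏ j ∈ s.erase k, (X - C (E j))) = 0 := by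
  refine b.ext fun i => ?_
  obtain ⟨x, hx⟩ := hb i
  obtain ⟨j, hj, rfl⟩ := eigen_mem_of_aeval_prod_eq_zero hA (b.ne_zero i) hx
  rw [aeval_of_eigen hx, eval_prod, LinearMap.zero_apply]
  have : ∃ j' ∈ s.erase k, E j = E j' := by
    by_cases h : j = k
    · exact ⟨l, Finset.mem_erase.mpr ⟨hkl.symm, hl⟩, by rw [h, hE]⟩
    · exact ⟨j, Finset.mem_erase.mpr ⟨h, hj⟩, rfl⟩
  obtain ⟨j', hj', e⟩ := this
  rw [Finset.prod_eq_zero hj' (by simp [e]), zero_smul]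

/-- The spectral projection attached to the root `E k`, when the roots are distinct. -/
theorem mul_aeval_lagrange {A : Module.End ℂ U} {E : ℕ → ℂ} {s : Finset ℕ}
    (hA : aeval A (∏ k ∈ s, (X - C (E k))) = 0) {k : ℕ} (hk : k ∈ s) :
    A * aeval A (Lagrange.basis s E k) = E k • aeval A (Lagrange.basis s E k) := by
  have : Lagrange.basis s E k =
      C (∏ j ∈ s.erase k, (E k - E j)⁻¹) * ∏ j ∈ s.erase k, (X - C (E j)) := by
    rw [map_prod, ← Finset.prod_mul_distrib]; rfl
  rw [this, map_mul, aeval_C, Algebra.algebraMap_eq_smul_one, smul_mul_assoc, one_mul,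
    mul_smul_comm, mul_aeval_erase hA hk, smul_comm]

variable {A B : Module.End ℂ U} {E F : ℕ → ℂ} {s t : Finset ℕ}
  (hA : aeval A (∏ k ∈ s, (X - C (E k))) = 0) (hB : aeval B (∏ k ∈ t, (X - C (F k))) = 0)
  (hAB : Commute A B)
include hA hB hAB

/-- Distinct roots give Lagrange idempotents summing to `1`. Their products for `A` and `B` cut any
vector into common eigenvectors, so these span and a basis can be chosen among them. -/
theorem simultaneouslyDiagonalisable_of_injOn (hs : s.Nonempty) (ht : t.Nonempty)
    (hE : Set.InjOn E s) (hF : Set.InjOn F t) : SimultaneouslyDiagonalisable A B := by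
  let S : Set U := {v | ∃ c : ℂ × ℂ, IsJointEigen A B c v}
  have hS : ⊤ ≤ Submodule.span ℂ S := by
    intro v _
    have e1 : ∑ k ∈ s, aeval A (Lagrange.basis s E k) = 1 := by
      rw [← map_sum, Lagrange.sum_basis hE hs, map_one]
    have e2 : ∑ l ∈ t, aeval B (Lagrange.basis t F l) = 1 := by
      rw [← map_sum, Lagrange.sum_basis hF ht, map_one]
    have e3 : v = ∑ k ∈ s, ∑ l ∈ t,
        (aeval A (Lagrange.basis s E k) * aeval B (Lagrange.basis t F l)) v := by
      have : (∑ k ∈ s, aeval A (Lagrange.basis s E k)) * (∑ l ∈ t, aeval B (Lagrange.basis t F l))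
          = 1 := by rw [e1, e2, one_mul]
      rw [Finset.sum_mul_sum] at this
      have := congrArg (fun g : Module.End ℂ U => g v) this
      simpa [LinearMap.sum_apply] using this.symm
    rw [e3]
    refine Submodule.sum_mem _ fun k hk => Submodule.sum_mem _ fun l hl =>
      Submodule.subset_span ⟨(E k, F l), ?_, ?_⟩
    · rw [← Module.End.mul_apply, ← mul_assoc, mul_aeval_lagrange hA hk]; rfl
    · have hc : Commute (aeval A (Lagrange.basis s E k)) B := Triple.commute_aeval hAB _
      rw [← Module.End.mul_apply, ← mul_assoc, ← hc.eq, mul_assoc, mul_aeval_lagrange hB hl,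
        mul_smul_comm]
      rfl
  refine ⟨_, Module.Basis.ofSpan hS, fun i => ?_⟩
  exact Module.Basis.ofSpan_subset hS ⟨i, rfl⟩

variable (hne : ∀ k ∈ s, ∀ l ∈ t, aeval A (∏ j ∈ s.erase k, (X - C (E j))) *
    aeval B (∏ j ∈ t.erase l, (X - C (F j))) ≠ 0)
include hne

theorem simultaneouslyDiagonalisable_iff_injOn (hs : s.Nonempty) (ht : t.Nonempty) :
    SimultaneouslyDiagonalisable A B ↔ Set.InjOn E s ∧ Set.InjOn F t := by
  refine ⟨fun ⟨ι, b, hb⟩ => ⟨fun k hk l hl h => ?_, fun k hk l hl h => ?_⟩, fun h =>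
    simultaneouslyDiagonalisable_of_injOn hA hB hAB hs ht h.1 h.2⟩
  · by_contra hkl
    obtain ⟨m, hm⟩ := ht
    refine hne k hk m hm ?_
    rw [aeval_erase_eq_zero_of_not_injOn hA b (fun i => (hb i).imp' Prod.fst fun _ h => h.1) hl
      hkl h, zero_mul]
  · by_contra hkl
    obtain ⟨m, hm⟩ := hs
    refine hne m hm k hk ?_
    rw [aeval_erase_eq_zero_of_not_injOn hB b (fun i => (hb i).imp' Prod.snd fun _ h => h.2) hl
      hkl h, mul_zero]

/-- Any nonzero value of the product of the two shortened polynomials is a common eigenvector for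
the two omitted roots, whether or not the roots are distinct. -/
theorem jointEigenvalues_eq :
    jointEigenvalues A B = (fun p : ℕ × ℕ => (E p.1, F p.2)) '' (s ×ˢ t : Set (ℕ × ℕ)) := by
  ext c
  constructor
  · rintro ⟨v, hv, h1, h2⟩
    obtain ⟨k, hk, ek⟩ := eigen_mem_of_aeval_prod_eq_zero hA hv h1
    obtain ⟨l, hl, el⟩ := eigen_mem_of_aeval_prod_eq_zero hB hv h2
    exact ⟨(k, l), ⟨hk, hl⟩, Prod.ext ek.symm el.symm⟩
  · rintro ⟨⟨k, l⟩, ⟨hk, hl⟩, rfl⟩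
    have := hne k hk l hl
    have hc : Commute (aeval A (∏ j ∈ s.erase k, (X - C (E j)))) B := Triple.commute_aeval hAB _
    obtain ⟨v, hv⟩ := not_forall.mp fun h => this (LinearMap.ext h)
    refine ⟨_, hv, ?_, ?_⟩
    · rw [← Module.End.mul_apply, ← mul_assoc, mul_aeval_erase hA hk]; rfl
    · rw [← Module.End.mul_apply, ← mul_assoc, ← hc.eq, mul_assoc, mul_aeval_erase hB hl,
        mul_smul_comm]
      rfl

end Joint

/-! ### A rescaled basis of `V` in which the square roots in `m` disappear. -/

/-- `1 / √(a!)`, and `0` for negative `a`. -/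
def invSqrtFact (a : ℤ) : ℂ := if a < 0 then 0 else ((Real.sqrt (a.toNat.factorial : ℝ) : ℂ))⁻¹

theorem rsqrt_mul_self {q : ℚ} (h : 0 ≤ q) : rsqrt q * rsqrt q = q := by
  rw [rsqrt, ← Complex.ofReal_mul, Real.mul_self_sqrt (by exact_mod_cast h)]
  simp

theorem rsqrt_of_nonpos {q : ℚ} (h : q ≤ 0) : rsqrt q = 0 := by
  rw [rsqrt, Real.sqrt_eq_zero_of_nonpos (by exact_mod_cast h), Complex.ofReal_zero]

theorem rsqrt_ne_zero {q : ℚ} (h : 0 < q) : rsqrt q ≠ 0 := by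
  intro h0
  have := rsqrt_mul_self h.le
  rw [h0, zero_mul] at this
  have : q = 0 := by exact_mod_cast this.symm
  exact h.ne' this

theorem invSqrtFact_ne_zero {a : ℤ} (h : 0 ≤ a) : invSqrtFact a ≠ 0 := by
  rw [invSqrtFact, if_neg (not_lt.mpr h)]
  have : (0 : ℝ) < a.toNat.factorial := by exact_mod_cast Nat.factorial_pos _
  exact inv_ne_zero (Complex.ofReal_ne_zero.mpr (Real.sqrt_pos.mpr this).ne')

theorem invSqrtFact_of_neg {a : ℤ} (h : a < 0) : invSqrtFact a = 0 := if_pos h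

theorem invSqrtFact_succ_mul {a : ℤ} (h : 0 ≤ a) :
    invSqrtFact (a + 1) * rsqrt ((a : ℚ) + 1) = invSqrtFact a := by
  obtain ⟨n, rfl⟩ := Int.eq_ofNat_of_zero_le h
  have h1 : ¬ ((n : ℤ) + 1 < 0) := by omega
  have h2 : ¬ ((n : ℤ) < 0) := by omega
  have h3 : ((n : ℤ) + 1).toNat = n + 1 := by omega
  rw [invSqrtFact, invSqrtFact, if_neg h1, if_neg h2, h3, Int.toNat_natCast, rsqrt,
    Nat.factorial_succ]
  have h4 : Real.sqrt ((n : ℝ) + 1) ≠ 0 := (Real.sqrt_pos.mpr (by positivity)).ne'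
  have h5 : Real.sqrt (n.factorial : ℝ) ≠ 0 :=
    (Real.sqrt_pos.mpr (by exact_mod_cast n.factorial_pos)).ne'
  push_cast
  rw [Real.sqrt_mul (by positivity)]
  have h4' := Complex.ofReal_ne_zero.mpr h4
  have h5' := Complex.ofReal_ne_zero.mpr h5
  push_cast
  field_simp

theorem invSqrtFact_mul_rsqrt (a : ℤ) : invSqrtFact a * rsqrt a = invSqrtFact (a - 1) := by
  rcases lt_trichotomy a 0 with h | rfl | h
  · rw [invSqrtFact_of_neg h, invSqrtFact_of_neg (by omega), zero_mul]
  · rw [invSqrtFact_of_neg (a := 0 - 1) (by omega), rsqrt_of_nonpos (by simp), mul_zero]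
  · have := invSqrtFact_succ_mul (a := a - 1) (by omega)
    simpa using this

/-- The factor `a + 1` makes this true also at `a = -1`, where the left side is `0` although
`invSqrtFact 0` is not. -/
theorem invSqrtFact_mul_rsqrt_succ (a : ℤ) :
    invSqrtFact a * rsqrt ((a : ℚ) + 1) = ((a : ℂ) + 1) * invSqrtFact (a + 1) := by
  rcases lt_or_ge a 0 with h | h
  · rw [invSqrtFact_of_neg h, zero_mul]
    rcases eq_or_ne a (-1) with rfl | h'
    · simp
    · rw [invSqrtFact_of_neg (a := a + 1) (by omega), mul_zero]
  · rw [← invSqrtFact_succ_mul h, mul_assoc, rsqrt_mul_self (by exact_mod_cast (by omega))]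
    push_cast; ring

theorem mem_magnetic_iff {j : ℚ} {a b : ℤ} (hj : j = ((a : ℚ) + b) / 2) :
    ((a : ℚ) - b) / 2 ∈ magnetic j ↔ 0 ≤ a ∧ 0 ≤ b := by
  subst hj
  constructor
  · rintro ⟨n, h1, h2⟩
    have : (a : ℚ) = n := by linarith
    have h3 : a = n := by exact_mod_cast this
    have h4 : (0 : ℚ) ≤ b := by linarith
    exact ⟨by omega, by exact_mod_cast h4⟩
  · rintro ⟨h1, h2⟩
    obtain ⟨n, rfl⟩ := Int.eq_ofNat_of_zero_le h1
    have : (0 : ℚ) ≤ b := by exact_mod_cast h2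
    exact ⟨n, by push_cast; ring, by linarith⟩

section Irreducible

variable (l : ℚ) (ρ : ℂ)

/-- The rescaled basis vector `|j,m⟩ / √((j+m)! (j-m)!)` with `j + m = a` and `j - m = b`. -/
def mono (a b : ℤ) : Space l ρ :=
  (invSqrtFact a * invSqrtFact b) • ket l ρ (((a : ℚ) + b) / 2) (((a : ℚ) - b) / 2)

/-- `P⁻(s/2)`. -/
def pm (s : ℤ) : ℂ := Pminus l ρ ((s : ℚ) / 2)

/-- `P(s/2)`. -/
def pz (s : ℤ) : ℂ := Pzero l ρ ((s : ℚ) / 2)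

/-- The ladder of spins does not break off. -/
def Unbounded : Prop := ∀ k : ℕ, Pplus l ρ (|l| + k) ≠ 0

variable {l ρ}

theorem Unbounded.mem_spins_iff (h : Unbounded l ρ) {j : ℚ} :
    j ∈ spins l ρ ↔ ∃ n : ℕ, j = |l| + n :=
  ⟨fun ⟨n, hn, _⟩ => ⟨n, hn⟩, fun ⟨n, hn⟩ => ⟨n, hn, fun k _ => h k⟩⟩

theorem onBasis_ket {f : ℚ → ℚ → Space l ρ} {j m : ℚ} (h : j ∈ spins l ρ ∧ m ∈ magnetic j) :
    onBasis l ρ f (ket l ρ j m) = f j m := by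
  rw [ket, dif_pos h, onBasis, Finsupp.linearCombination_single, one_smul]

theorem ket_of_notMem {j m : ℚ} (h : j ∉ spins l ρ) : ket l ρ j m = 0 :=
  dif_neg fun h' => h h'.1

theorem mono_of_notMem {a b : ℤ} (h : ((a : ℚ) + b) / 2 ∉ spins l ρ) : mono l ρ a b = 0 := by
  rw [mono, ket_of_notMem h, smul_zero]

theorem onBasis_mono {f : ℚ → ℚ → Space l ρ} {a b : ℤ} (h : ((a : ℚ) + b) / 2 ∈ spins l ρ) :
    onBasis l ρ f (mono l ρ a b) =
      (invSqrtFact a * invSqrtFact b) • f (((a : ℚ) + b) / 2) (((a : ℚ) - b) / 2) := by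
  by_cases h' : 0 ≤ a ∧ 0 ≤ b
  · rw [mono, map_smul, onBasis_ket ⟨h, (mem_magnetic_iff rfl).mpr h'⟩]
  · have : invSqrtFact a * invSqrtFact b = 0 := by
      rcases not_and_or.mp h' with h | h
      · rw [invSqrtFact_of_neg (by omega), zero_mul]
      · rw [invSqrtFact_of_neg (a := b) (by omega), mul_zero]
    rw [mono, this, zero_smul, zero_smul, map_zero]

theorem mono_eq {a b a' b' : ℤ} {j m : ℚ} (hj : j = ((a : ℚ) + b) / 2) (hm : m = ((a : ℚ) - b) / 2)
    (ha : a' = a) (hb : b' = b) :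
    mono l ρ a' b' = (invSqrtFact a * invSqrtFact b) • ket l ρ j m := by
  subst hj hm ha hb; rfl

theorem J₀_mono (a b : ℤ) : J₀ l ρ (mono l ρ a b) = (((a : ℂ) - b) / 2) • mono l ρ a b := by
  by_cases h : ((a : ℚ) + b) / 2 ∈ spins l ρ
  · rw [J₀, onBasis_mono h, mono, smul_comm]
    push_cast; rfl
  · rw [mono_of_notMem h, map_zero, smul_zero]

theorem Jplus_mono (a b : ℤ) :
    Jplus l ρ (mono l ρ a b) = ((a : ℂ) + 1) • mono l ρ (a + 1) (b - 1) := by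
  by_cases h : ((a : ℚ) + b) / 2 ∈ spins l ρ
  · rw [Jplus, onBasis_mono h, mono_eq (a := a + 1) (b := b - 1) (j := ((a : ℚ) + b) / 2)
      (m := ((a : ℚ) - b) / 2 + 1) (by push_cast; ring) (by push_cast; ring) rfl rfl,
      smul_smul, smul_smul]
    congr 1
    rw [Cp, show ((a : ℚ) + b) / 2 - (a - b) / 2 = b by ring,
      show ((a : ℚ) + b) / 2 + (a - b) / 2 = a by ring, ← invSqrtFact_mul_rsqrt b]
    linear_combination invSqrtFact b * rsqrt b * invSqrtFact_mul_rsqrt_succ a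
  · rw [mono_of_notMem h, map_zero, mono_of_notMem, smul_zero]
    convert h using 2; push_cast; ring

theorem Jminus_mono (a b : ℤ) :
    Jminus l ρ (mono l ρ a b) = ((b : ℂ) + 1) • mono l ρ (a - 1) (b + 1) := by
  by_cases h : ((a : ℚ) + b) / 2 ∈ spins l ρ
  · rw [Jminus, onBasis_mono h, mono_eq (a := a - 1) (b := b + 1) (j := ((a : ℚ) + b) / 2)
      (m := ((a : ℚ) - b) / 2 - 1) (by push_cast; ring) (by push_cast; ring) rfl rfl,
      smul_smul, smul_smul]
    congr 1
    rw [Cm, show ((a : ℚ) + b) / 2 - (a - b) / 2 = b by ring,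
      show ((a : ℚ) + b) / 2 + (a - b) / 2 = a by ring, ← invSqrtFact_mul_rsqrt a]
    linear_combination invSqrtFact a * rsqrt a * invSqrtFact_mul_rsqrt_succ b
  · rw [mono_of_notMem h, map_zero, mono_of_notMem, smul_zero]
    convert h using 2; push_cast; ring

theorem Pminus_abs : Pminus l ρ |l| = 0 := by
  have : rsqrt (|l| + l) * rsqrt (|l| - l) = 0 := by
    rcases abs_choice l with h | h
    · rw [h, sub_self, rsqrt_of_nonpos le_rfl, mul_zero]
    · rw [h, neg_add_cancel, rsqrt_of_nonpos le_rfl, zero_mul]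
  rw [Pminus, this]; simp

/-- A step up from a non-spin can reach only the lowest spin `|λ|`, and there `P⁻` vanishes. With
`down_eq_zero` this makes the formulas for `K` on `mono a b` hold for all integers `a, b`. -/
theorem Unbounded.up_eq_zero (h : Unbounded l ρ) {s a b : ℤ} (hs : s + 2 = a + b)
    (hn : (s : ℚ) / 2 ∉ spins l ρ) : pm l ρ (s + 2) • mono l ρ a b = 0 := by
  have hs' : ((s : ℚ) + 2) = a + b := by exact_mod_cast hs
  by_cases h' : ((a : ℚ) + b) / 2 ∈ spins l ρ
  · obtain ⟨n, hn'⟩ := h.mem_spins_iff.mp h'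
    rw [h.mem_spins_iff] at hn
    cases n with
    | zero =>
      have : (((s + 2 : ℤ) : ℚ)) / 2 = |l| := by push_cast; rw [hs', hn']; simp
      rw [pm, this, Pminus_abs, zero_smul]
    | succ n => exact absurd ⟨n, by push_cast at hn'; linarith⟩ hn
  · rw [mono_of_notMem h', smul_zero]

theorem Unbounded.down_eq_zero (h : Unbounded l ρ) {s a b : ℤ} (hs : s - 2 = a + b)
    (hn : (s : ℚ) / 2 ∉ spins l ρ) : mono l ρ a b = 0 := by
  have hs' : ((s : ℚ) - 2) = a + b := by exact_mod_cast hs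
  refine mono_of_notMem fun h' => hn ?_
  rw [h.mem_spins_iff] at h' ⊢
  obtain ⟨n, hn'⟩ := h'
  exact ⟨n + 1, by push_cast; linarith⟩

theorem Pplus_half (a b : ℤ) : Pplus l ρ (((a : ℚ) + b) / 2) = pm l ρ (a + b + 2) := by
  rw [Pplus, pm]; congr 1; push_cast; ring

theorem Pminus_half (a b : ℤ) : Pminus l ρ (((a : ℚ) + b) / 2) = pm l ρ (a + b) := by
  rw [pm]; push_cast; rfl

theorem Pzero_half (a b : ℤ) : Pzero l ρ (((a : ℚ) + b) / 2) = pz l ρ (a + b) := by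
  rw [pz]; push_cast; rfl

theorem Unbounded.K₀_mono (hu : Unbounded l ρ) (a b : ℤ) :
    K₀ l ρ (mono l ρ a b) =
      (((a : ℂ) + 1) * (b + 1)) • pm l ρ (a + b + 2) • mono l ρ (a + 1) (b + 1)
      + (pz l ρ (a + b) * (((a : ℂ) - b) / 2)) • mono l ρ a b
      + pm l ρ (a + b) • mono l ρ (a - 1) (b - 1) := by
  by_cases h : ((a : ℚ) + b) / 2 ∈ spins l ρ
  · rw [K₀, onBasis_mono h, smul_add, smul_add]
    rw [mono_eq (a := a + 1) (b := b + 1) (j := ((a : ℚ) + b) / 2 + 1)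
      (m := ((a : ℚ) - b) / 2) (by push_cast; ring) (by push_cast; ring) rfl rfl,
      mono_eq (a := a - 1) (b := b - 1) (j := ((a : ℚ) + b) / 2 - 1)
      (m := ((a : ℚ) - b) / 2) (by push_cast; ring) (by push_cast; ring) rfl rfl,
      mono_eq (a := a) (b := b) (j := ((a : ℚ) + b) / 2)
      (m := ((a : ℚ) - b) / 2) rfl rfl rfl rfl, Pplus_half, Pminus_half, Pzero_half]
    simp only [smul_smul]
    rw [show ((a : ℚ) + b) / 2 - (a - b) / 2 = b by ring,
      show ((a : ℚ) + b) / 2 + (a - b) / 2 = a by ring, ← invSqrtFact_mul_rsqrt a,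
      ← invSqrtFact_mul_rsqrt b]
    congr 1
    · congr 1
      · congr 1
        linear_combination pm l ρ (a + b + 2) * (invSqrtFact b * rsqrt (b + 1) *
          invSqrtFact_mul_rsqrt_succ a +
            (a + 1) * invSqrtFact (a + 1) * invSqrtFact_mul_rsqrt_succ b)
      · congr 1; push_cast; ring
    · congr 1; ring
  · have h' : (((a + b : ℤ) : ℚ)) / 2 ∉ spins l ρ := by push_cast; exact h
    rw [mono_of_notMem h, map_zero, hu.up_eq_zero (by ring) h', hu.down_eq_zero (by ring) h']
    simp

theorem Unbounded.Kplus_mono (hu : Unbounded l ρ) (a b : ℤ) :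
    Kplus l ρ (mono l ρ a b) =
      (-(((a : ℂ) + 1) * (a + 2))) • pm l ρ (a + b + 2) • mono l ρ (a + 2) b
      + (pz l ρ (a + b) * ((a : ℂ) + 1)) • mono l ρ (a + 1) (b - 1)
      + pm l ρ (a + b) • mono l ρ a (b - 2) := by
  by_cases h : ((a : ℚ) + b) / 2 ∈ spins l ρ
  · rw [Kplus, onBasis_mono h, smul_add, smul_add]
    rw [mono_eq (a := a + 2) (b := b) (j := ((a : ℚ) + b) / 2 + 1)
      (m := ((a : ℚ) - b) / 2 + 1) (by push_cast; ring) (by push_cast; ring) rfl rfl,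
      mono_eq (a := a) (b := b - 2) (j := ((a : ℚ) + b) / 2 - 1)
      (m := ((a : ℚ) - b) / 2 + 1) (by push_cast; ring) (by push_cast; ring) rfl rfl,
      mono_eq (a := a + 1) (b := b - 1) (j := ((a : ℚ) + b) / 2)
      (m := ((a : ℚ) - b) / 2 + 1) (by push_cast; ring) (by push_cast; ring) rfl rfl,
      Pplus_half, Pminus_half, Pzero_half]
    simp only [smul_smul]
    have e1 := invSqrtFact_mul_rsqrt_succ a
    have e2 := invSqrtFact_mul_rsqrt_succ (a + 1)
    have e3 := invSqrtFact_mul_rsqrt b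
    have e4 := invSqrtFact_mul_rsqrt (b - 1)
    rw [show a + 1 + 1 = a + 2 by ring] at e2
    rw [show b - 1 - 1 = b - 2 by ring] at e4
    push_cast at e2 e4
    rw [add_assoc, one_add_one_eq_two] at e2
    rw [Cp, show ((a : ℚ) + b) / 2 - (a - b) / 2 = b by ring,
      show ((a : ℚ) + b) / 2 + (a - b) / 2 = a by ring]
    congr 1
    · congr 1
      · congr 1
        linear_combination -pm l ρ (a + b + 2) * invSqrtFact b * (rsqrt (a + 2) * e1 + (a + 1) * e2)
      · congr 1
        linear_combination pz l ρ (a + b) * (invSqrtFact b * rsqrt b * e1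
          + (a + 1) * invSqrtFact (a + 1) * e3)
    · congr 1
      linear_combination pm l ρ (a + b) * invSqrtFact a * (rsqrt (b - 1) * e3 + e4)
  · have h' : (((a + b : ℤ) : ℚ)) / 2 ∉ spins l ρ := by push_cast; exact h
    rw [mono_of_notMem h, map_zero, hu.up_eq_zero (by ring) h',
      mono_of_notMem (a := a + 1) (b := b - 1) (by convert h using 2; push_cast; ring),
      hu.down_eq_zero (by ring) h']
    simp

theorem Unbounded.Kminus_mono (hu : Unbounded l ρ) (a b : ℤ) :
    Kminus l ρ (mono l ρ a b) =
      (((b : ℂ) + 1) * (b + 2)) • pm l ρ (a + b + 2) • mono l ρ a (b + 2)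
      + (pz l ρ (a + b) * ((b : ℂ) + 1)) • mono l ρ (a - 1) (b + 1)
      + (-pm l ρ (a + b)) • mono l ρ (a - 2) b := by
  by_cases h : ((a : ℚ) + b) / 2 ∈ spins l ρ
  · rw [Kminus, onBasis_mono h, smul_add, smul_add]
    rw [mono_eq (a := a) (b := b + 2) (j := ((a : ℚ) + b) / 2 + 1)
      (m := ((a : ℚ) - b) / 2 - 1) (by push_cast; ring) (by push_cast; ring) rfl rfl,
      mono_eq (a := a - 2) (b := b) (j := ((a : ℚ) + b) / 2 - 1)
      (m := ((a : ℚ) - b) / 2 - 1) (by push_cast; ring) (by push_cast; ring) rfl rfl,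
      mono_eq (a := a - 1) (b := b + 1) (j := ((a : ℚ) + b) / 2)
      (m := ((a : ℚ) - b) / 2 - 1) (by push_cast; ring) (by push_cast; ring) rfl rfl,
      Pplus_half, Pminus_half, Pzero_half]
    simp only [smul_smul]
    have e1 := invSqrtFact_mul_rsqrt_succ b
    have e2 := invSqrtFact_mul_rsqrt_succ (b + 1)
    have e3 := invSqrtFact_mul_rsqrt a
    have e4 := invSqrtFact_mul_rsqrt (a - 1)
    rw [show b + 1 + 1 = b + 2 by ring] at e2
    rw [show a - 1 - 1 = a - 2 by ring] at e4
    push_cast at e2 e4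
    rw [add_assoc, one_add_one_eq_two] at e2
    rw [Cm, show ((a : ℚ) + b) / 2 - (a - b) / 2 = b by ring,
      show ((a : ℚ) + b) / 2 + (a - b) / 2 = a by ring]
    congr 1
    · congr 1
      · congr 1
        linear_combination pm l ρ (a + b + 2) * invSqrtFact a * (rsqrt (b + 2) * e1 + (b + 1) * e2)
      · congr 1
        linear_combination pz l ρ (a + b) * (invSqrtFact a * rsqrt a * e1
          + (b + 1) * invSqrtFact (b + 1) * e3)
    · congr 1
      linear_combination -pm l ρ (a + b) * invSqrtFact b * (rsqrt (a - 1) * e3 + e4)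
  · have h' : (((a + b : ℤ) : ℚ)) / 2 ∉ spins l ρ := by push_cast; exact h
    rw [mono_of_notMem h, map_zero, hu.up_eq_zero (by ring) h',
      mono_of_notMem (a := a - 1) (b := b + 1) (by convert h using 2; push_cast; ring),
      hu.down_eq_zero (by ring) h']
    simp

end Irreducible

/-! ### Algebraic relations between the coefficients `P⁻` and `P`. -/

section Irreducible

variable {l : ℚ} {ρ : ℂ}

theorem csqrt_mul_self (z : ℂ) : Complex.sqrt z * Complex.sqrt z = z := by
  rw [← sq]
  simp [Complex.sqrt]

theorem Pminus_sq {j : ℚ} (h1 : |l| ≤ j) (h2 : 1 ≤ j) :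
    (4 * (j : ℂ) ^ 2 - 1) * (j : ℂ) ^ 2 * (Pminus l ρ j) ^ 2 =
      ((j : ℂ) ^ 2 - l ^ 2) * ((j : ℂ) ^ 2 - ρ ^ 2) := by
  obtain ⟨h3, h4⟩ := abs_le.mp h1
  have e1 := rsqrt_mul_self (q := j + l) (by linarith)
  have e2 := rsqrt_mul_self (q := j - l) (by linarith)
  have e3 := rsqrt_mul_self (q := 2 * j + 1) (by linarith)
  have e4 := rsqrt_mul_self (q := 2 * j - 1) (by linarith)
  have n1 : (j : ℂ) ≠ 0 := by exact_mod_cast (by linarith : j ≠ 0)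
  have n3 : rsqrt (2 * j + 1) ≠ 0 := rsqrt_ne_zero (by linarith)
  have n4 : rsqrt (2 * j - 1) ≠ 0 := rsqrt_ne_zero (by linarith)
  have e5 := csqrt_mul_self ((j : ℂ) + ρ)
  have e6 := csqrt_mul_self ((j : ℂ) - ρ)
  rw [Pminus, div_pow]
  push_cast at e1 e2 e3 e4
  have e7 : ((j : ℂ) * rsqrt (2 * j + 1) * rsqrt (2 * j - 1)) ^ 2 =
      (4 * (j : ℂ) ^ 2 - 1) * (j : ℂ) ^ 2 := by
    rw [show ((j : ℂ) * rsqrt (2 * j + 1) * rsqrt (2 * j - 1)) ^ 2 = (j : ℂ) ^ 2 *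
      ((rsqrt (2 * j + 1) * rsqrt (2 * j + 1)) * (rsqrt (2 * j - 1) * rsqrt (2 * j - 1))) by ring,
      e3, e4]
    ring
  rw [show (rsqrt (j + l) * rsqrt (j - l) * Complex.sqrt (↑j + ρ) * Complex.sqrt (↑j - ρ)) ^ 2 =
    (rsqrt (j + l) * rsqrt (j + l)) * (rsqrt (j - l) * rsqrt (j - l)) *
      (Complex.sqrt (↑j + ρ) * Complex.sqrt (↑j + ρ)) *
      (Complex.sqrt (↑j - ρ) * Complex.sqrt (↑j - ρ)) by ring, e1, e2, e5, e6, ← e7,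
    mul_div_cancel₀]
  · ring
  · exact pow_ne_zero 2 (mul_ne_zero (mul_ne_zero n1 n3) n4)

/-- `s / 2` is one of the spins of an unbounded ladder of spins. -/
structure IsSpin (l : ℚ) (ρ : ℂ) (s : ℤ) : Prop where
  unbounded : Unbounded l ρ
  mem : ∃ n : ℕ, (s : ℚ) / 2 = |l| + n

namespace IsSpin

variable {s : ℤ} (h : IsSpin l ρ s)
include h

theorem nonneg : 0 ≤ s := by
  obtain ⟨n, hn⟩ := h.mem
  have : (0 : ℚ) ≤ s := by linarith [abs_nonneg l, (n.cast_nonneg : (0 : ℚ) ≤ n)]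
  exact_mod_cast this

theorem abs_le : |l| ≤ (s : ℚ) / 2 := by
  obtain ⟨n, hn⟩ := h.mem
  linarith [(n.cast_nonneg : (0 : ℚ) ≤ n)]

theorem succ : IsSpin l ρ (s + 2) :=
  ⟨h.unbounded, by obtain ⟨n, hn⟩ := h.mem; exact ⟨n + 1, by push_cast; linarith⟩⟩

theorem pred : IsSpin l ρ (s - 2) ∨ pm l ρ s = 0 := by
  obtain ⟨n, hn⟩ := h.mem
  cases n with
  | zero =>
    right
    rw [pm, hn]
    simpa using Pminus_abs
  | succ n =>
    left
    exact ⟨h.unbounded, n, by push_cast at hn ⊢; linarith⟩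

theorem eq_zero_of_zero (h0 : s = 0) : l = 0 := by
  have := h.abs_le
  rw [h0] at this
  simpa using this

theorem pm_sq : 4 * (s : ℂ) ^ 2 * (s + 1) * (s - 1) * (pm l ρ s) ^ 2 =
    ((s : ℂ) ^ 2 - 4 * l ^ 2) * (s ^ 2 - 4 * ρ ^ 2) := by
  by_cases h2 : 2 ≤ s
  · have h2' : (2 : ℚ) ≤ s := by exact_mod_cast h2
    have := Pminus_sq (l := l) (ρ := ρ) h.abs_le (by linarith)
    push_cast at this
    rw [pm]
    linear_combination 16 * this
  · have h0 : s = 0 ∨ s = 1 := by have := h.nonneg; omega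
    rcases h0 with rfl | rfl
    · simp [h.eq_zero_of_zero rfl]
    · obtain ⟨n, hn⟩ := h.mem
      have hl : n = 0 := by
        by_contra hn0
        have : (1 : ℚ) ≤ n := by exact_mod_cast Nat.one_le_iff_ne_zero.mpr hn0
        push_cast at hn
        linarith [abs_nonneg l]
      have hl' : (l : ℂ) ^ 2 = 1 / 4 := by
        have : l ^ 2 = 1 / 4 := by
          rw [← sq_abs, show |l| = 1 / 2 by rw [hl] at hn; push_cast at hn; linarith]; norm_num
        have := congrArg (Rat.cast (K := ℂ)) this
        push_cast at this
        exact this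
      rw [hl']; push_cast; ring

theorem pz_mul : (s : ℂ) * (s + 2) * pz l ρ s = 4 * Complex.I * l * ρ := by
  by_cases h0 : s = 0
  · simp [h0, h.eq_zero_of_zero h0]
  · have n1 : (s : ℂ) ≠ 0 := by exact_mod_cast h0
    have n2 : (s : ℂ) + 2 ≠ 0 := by have := h.nonneg; exact_mod_cast (by omega : s + 2 ≠ 0)
    have n3 : (s : ℚ) / 2 ≠ 0 := div_ne_zero (by exact_mod_cast h0) two_ne_zero
    rw [pz, Pzero, if_neg n3]
    push_cast
    field_simp
    ring

theorem pz_succ : ((s : ℂ) + 4) * pz l ρ (s + 2) = s * pz l ρ s := by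
  have e1 := h.pz_mul
  have e2 := h.succ.pz_mul
  push_cast at e2
  have n2 : (s : ℂ) + 2 ≠ 0 := by have := h.nonneg; exact_mod_cast (by omega : s + 2 ≠ 0)
  refine mul_left_cancel₀ n2 ?_
  linear_combination e2 - e1

theorem pz_pred : pm l ρ s * ((s + 2) * pz l ρ s - (s - 2) * pz l ρ (s - 2)) = 0 := by
  rcases h.pred with h' | h'
  · have := h'.pz_succ
    push_cast at this
    rw [sub_add_cancel] at this
    linear_combination pm l ρ s * this
  · rw [h', zero_mul]

/-- This is the diagonal part of `[K₀, K₊] = -J₊`. At `s = 0` it would fail in general. -/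
theorem pm_rec (h0 : s ≠ 0) :
    ((s : ℂ) + 3) * (pm l ρ (s + 2)) ^ 2 - (s - 1) * (pm l ρ s) ^ 2 - (pz l ρ s) ^ 2 = 1 := by
  have e1 := h.pz_mul
  have e2 := h.pm_sq
  have e3 := h.succ.pm_sq
  push_cast at e3
  have n0 : (s : ℂ) ≠ 0 := by exact_mod_cast h0
  have n1 : (s : ℂ) + 1 ≠ 0 := by have := h.nonneg; exact_mod_cast (by omega : s + 1 ≠ 0)
  have n2 : (s : ℂ) + 2 ≠ 0 := by have := h.nonneg; exact_mod_cast (by omega : s + 2 ≠ 0)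
  have n : 4 * (s : ℂ) ^ 2 * (s + 2) ^ 2 * (s + 1) ≠ 0 := by simp [n0, n1, n2]
  refine mul_left_cancel₀ n ?_
  linear_combination (s : ℂ) ^ 2 * e3 - (s + 2) ^ 2 * e2
    - 4 * (s + 1) * (s * (s + 2) * pz l ρ s + 4 * Complex.I * l * ρ) * e1
    - 64 * (s + 1) * l ^ 2 * ρ ^ 2 * Complex.I_sq

/-- The diagonal coefficient of `J² - K²`, multiplied by `4`. -/
theorem pm_casimir :
    (s : ℂ) * (s + 2) * (1 - (pz l ρ s) ^ 2) - 2 * (s + 2) * (s + 3) * (pm l ρ (s + 2)) ^ 2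
      - 2 * s * (s - 1) * (pm l ρ s) ^ 2 = 4 * (l ^ 2 + ρ ^ 2 - 1) := by
  have e1 := h.pz_mul
  have e2 := h.pm_sq
  have e3 := h.succ.pm_sq
  push_cast at e3
  by_cases h0 : s = 0
  · have hl := h.eq_zero_of_zero h0
    subst h0 hl
    push_cast at e3 ⊢
    linear_combination -1 / 4 * e3
  have n0 : (s : ℂ) ≠ 0 := by exact_mod_cast h0
  have n1 : (s : ℂ) + 1 ≠ 0 := by have := h.nonneg; exact_mod_cast (by omega : s + 1 ≠ 0)
  have n2 : (s : ℂ) + 2 ≠ 0 := by have := h.nonneg; exact_mod_cast (by omega : s + 2 ≠ 0)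
  have n : 2 * (s : ℂ) * (s + 2) * (s + 1) ≠ 0 := by simp [n0, n1, n2]
  refine mul_left_cancel₀ n ?_
  linear_combination - (s : ℂ) * e3 - (s + 2) * e2
    - 2 * (s + 1) * (s * (s + 2) * pz l ρ s + 4 * Complex.I * l * ρ) * e1
    - 32 * (s + 1) * l ^ 2 * ρ ^ 2 * Complex.I_sq

end IsSpin

variable (l ρ) in
/-- The vector `mono l ρ a (s - a)`. -/
def wt (s a : ℤ) : Space l ρ := mono l ρ a (s - a)

theorem J₀_wt (s a : ℤ) : J₀ l ρ (wt l ρ s a) = ((a : ℂ) - s / 2) • wt l ρ s a := by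
  rw [wt, J₀_mono]; push_cast; congr 1; ring

theorem Jplus_wt (s a : ℤ) : Jplus l ρ (wt l ρ s a) = ((a : ℂ) + 1) • wt l ρ s (a + 1) := by
  rw [wt, Jplus_mono, wt]; congr 2; ring

theorem Jminus_wt (s a : ℤ) : Jminus l ρ (wt l ρ s a) = ((s : ℂ) - a + 1) • wt l ρ s (a - 1) := by
  rw [wt, Jminus_mono, wt]; push_cast; congr 2; ring

namespace Unbounded

variable (h : Unbounded l ρ)
include h

theorem K₀_wt (s a : ℤ) : K₀ l ρ (wt l ρ s a) =
    (((a : ℂ) + 1) * (s - a + 1) * pm l ρ (s + 2)) • wt l ρ (s + 2) (a + 1)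
      + (pz l ρ s * ((a : ℂ) - s / 2)) • wt l ρ s a + pm l ρ s • wt l ρ (s - 2) (a - 1) := by
  rw [wt, h.K₀_mono, wt, wt, add_sub_cancel, show s + 2 - (a + 1) = s - a + 1 by ring,
    show s - 2 - (a - 1) = s - a - 1 by ring, smul_smul]
  push_cast
  congr 3; ring

theorem Kplus_wt (s a : ℤ) : Kplus l ρ (wt l ρ s a) =
    (-(((a : ℂ) + 1) * (a + 2) * pm l ρ (s + 2))) • wt l ρ (s + 2) (a + 2)
      + (pz l ρ s * ((a : ℂ) + 1)) • wt l ρ s (a + 1) + pm l ρ s • wt l ρ (s - 2) a := by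
  rw [wt, h.Kplus_mono, wt, wt, wt, add_sub_cancel, show s + 2 - (a + 2) = s - a by ring,
    show s - 2 - a = s - a - 2 by ring, show s - (a + 1) = s - a - 1 by ring, smul_smul, neg_mul]

theorem Kminus_wt (s a : ℤ) : Kminus l ρ (wt l ρ s a) =
    (((s : ℂ) - a + 1) * (s - a + 2) * pm l ρ (s + 2)) • wt l ρ (s + 2) a
      + (pz l ρ s * ((s : ℂ) - a + 1)) • wt l ρ s (a - 1)
      + (-pm l ρ s) • wt l ρ (s - 2) (a - 2) := by
  rw [wt, h.Kminus_mono, wt, wt, wt, add_sub_cancel, show s + 2 - a = s - a + 2 by ring,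
    show s - 2 - (a - 2) = s - a by ring, show s - (a - 1) = s - a + 1 by ring, smul_smul]
  push_cast; rfl

theorem end_ext {N : ℕ} (hN : |l| = N / 2) {f g : Module.End ℂ (Space l ρ)}
    (hfg : ∀ s a : ℤ, IsSpin l ρ s → f (wt l ρ s a) = g (wt l ρ s a)) : f = g := by
  refine Finsupp.lhom_ext' fun p => LinearMap.ext_ring ?_
  obtain ⟨⟨j, m⟩, hj, hm⟩ := p
  obtain ⟨n, hn⟩ := h.mem_spins_iff.mp hj
  obtain ⟨k, hk, hk'⟩ := id hm
  simp only at hk hk' hn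
  have e1 : j = (((k : ℤ) : ℚ) + ((N + 2 * n - k : ℤ) : ℚ)) / 2 := by
    push_cast; rw [hn, hN]; ring
  have e2 : m = (((k : ℤ) : ℚ) - ((N + 2 * n - k : ℤ) : ℚ)) / 2 := by
    rw [hk]; push_cast; rw [hn, hN]; ring
  have hb : (0 : ℤ) ≤ N + 2 * n - k := by
    have : (0 : ℚ) ≤ ((N + 2 * n - k : ℤ) : ℚ) := by linarith
    exact_mod_cast this
  have hc : invSqrtFact k * invSqrtFact (N + 2 * n - k) ≠ 0 :=
    mul_ne_zero (invSqrtFact_ne_zero (by omega)) (invSqrtFact_ne_zero hb)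
  have e3 : (Finsupp.single ⟨(j, m), hj, hm⟩ 1 : Space l ρ) =
      (invSqrtFact k * invSqrtFact (N + 2 * n - k))⁻¹ • wt l ρ (N + 2 * n) k := by
    rw [wt, mono, smul_smul, inv_mul_cancel₀ hc, one_smul, ← e1, ← e2, ket, dif_pos ⟨hj, hm⟩]
  change f (Finsupp.single _ 1) = g (Finsupp.single _ 1)
  rw [e3, map_smul, map_smul, hfg]
  exact ⟨h, n, by push_cast; rw [hN]; ring⟩

end Unbounded
end Irreducible

/-! ### Commutation relations and Casimirs of `V`. -/

section Irreducible
variable {l : ℚ} {ρ : ℂ}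
namespace Unbounded
variable (h : Unbounded l ρ) {N : ℕ} (hN : |l| = N / 2)
include h hN

set_option linter.unusedSimpArgs false
set_option linter.unnecessarySeqFocus false


theorem J₀_Jplus : J₀ l ρ * Jplus l ρ = Jplus l ρ * J₀ l ρ + Jplus l ρ := by
  refine h.end_ext hN fun s a _ => ?_
  simp only [Module.End.mul_apply, LinearMap.add_apply, LinearMap.sub_apply, LinearMap.smul_apply,
    Module.End.one_apply, two_mul, map_add, map_smul, h.K₀_wt, h.Kplus_wt, h.Kminus_wt, J₀_wt,
    Jplus_wt, Jminus_wt, add_assoc (G := ℤ), sub_add (α := ℤ), sub_sub (α := ℤ),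
    add_sub_assoc (G := ℤ), Int.reduceAdd, Int.reduceSub, sub_neg_eq_add, add_zero, sub_zero,
    sub_self, ← sub_eq_add_neg (G := ℤ)]
  push_cast
  match_scalars <;> ring

theorem J₀_Jminus : J₀ l ρ * Jminus l ρ = Jminus l ρ * J₀ l ρ - Jminus l ρ := by
  refine h.end_ext hN fun s a _ => ?_
  simp only [Module.End.mul_apply, LinearMap.add_apply, LinearMap.sub_apply, LinearMap.smul_apply,
    Module.End.one_apply, two_mul, map_add, map_smul, h.K₀_wt, h.Kplus_wt, h.Kminus_wt, J₀_wt,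
    Jplus_wt, Jminus_wt, add_assoc (G := ℤ), sub_add (α := ℤ), sub_sub (α := ℤ),
    add_sub_assoc (G := ℤ), Int.reduceAdd, Int.reduceSub, sub_neg_eq_add, add_zero, sub_zero,
    sub_self, ← sub_eq_add_neg (G := ℤ)]
  push_cast
  match_scalars <;> ring

theorem Jplus_Jminus : Jplus l ρ * Jminus l ρ = Jminus l ρ * Jplus l ρ + 2 * J₀ l ρ := by
  refine h.end_ext hN fun s a _ => ?_
  simp only [Module.End.mul_apply, LinearMap.add_apply, LinearMap.sub_apply, LinearMap.smul_apply,
    Module.End.one_apply, two_mul, map_add, map_smul, h.K₀_wt, h.Kplus_wt, h.Kminus_wt, J₀_wt,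
    Jplus_wt, Jminus_wt, add_assoc (G := ℤ), sub_add (α := ℤ), sub_sub (α := ℤ),
    add_sub_assoc (G := ℤ), Int.reduceAdd, Int.reduceSub, sub_neg_eq_add, add_zero, sub_zero,
    sub_self, ← sub_eq_add_neg (G := ℤ)]
  push_cast
  match_scalars <;> ring

theorem J₀_K₀ : J₀ l ρ * K₀ l ρ = K₀ l ρ * J₀ l ρ := by
  refine h.end_ext hN fun s a _ => ?_
  simp only [Module.End.mul_apply, LinearMap.add_apply, LinearMap.sub_apply, LinearMap.smul_apply,
    Module.End.one_apply, two_mul, map_add, map_smul, h.K₀_wt, h.Kplus_wt, h.Kminus_wt, J₀_wt,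
    Jplus_wt, Jminus_wt, add_assoc (G := ℤ), sub_add (α := ℤ), sub_sub (α := ℤ),
    add_sub_assoc (G := ℤ), Int.reduceAdd, Int.reduceSub, sub_neg_eq_add, add_zero, sub_zero,
    sub_self, ← sub_eq_add_neg (G := ℤ)]
  push_cast
  match_scalars <;> ring

theorem J₀_Kplus : J₀ l ρ * Kplus l ρ = Kplus l ρ * J₀ l ρ + Kplus l ρ := by
  refine h.end_ext hN fun s a _ => ?_
  simp only [Module.End.mul_apply, LinearMap.add_apply, LinearMap.sub_apply, LinearMap.smul_apply,
    Module.End.one_apply, two_mul, map_add, map_smul, h.K₀_wt, h.Kplus_wt, h.Kminus_wt, J₀_wt,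
    Jplus_wt, Jminus_wt, add_assoc (G := ℤ), sub_add (α := ℤ), sub_sub (α := ℤ),
    add_sub_assoc (G := ℤ), Int.reduceAdd, Int.reduceSub, sub_neg_eq_add, add_zero, sub_zero,
    sub_self, ← sub_eq_add_neg (G := ℤ)]
  push_cast
  match_scalars <;> ring

theorem J₀_Kminus : J₀ l ρ * Kminus l ρ = Kminus l ρ * J₀ l ρ - Kminus l ρ := by
  refine h.end_ext hN fun s a _ => ?_
  simp only [Module.End.mul_apply, LinearMap.add_apply, LinearMap.sub_apply, LinearMap.smul_apply,
    Module.End.one_apply, two_mul, map_add, map_smul, h.K₀_wt, h.Kplus_wt, h.Kminus_wt, J₀_wt,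
    Jplus_wt, Jminus_wt, add_assoc (G := ℤ), sub_add (α := ℤ), sub_sub (α := ℤ),
    add_sub_assoc (G := ℤ), Int.reduceAdd, Int.reduceSub, sub_neg_eq_add, add_zero, sub_zero,
    sub_self, ← sub_eq_add_neg (G := ℤ)]
  push_cast
  match_scalars <;> ring

theorem Jplus_K₀ : Jplus l ρ * K₀ l ρ = K₀ l ρ * Jplus l ρ - Kplus l ρ := by
  refine h.end_ext hN fun s a _ => ?_
  simp only [Module.End.mul_apply, LinearMap.add_apply, LinearMap.sub_apply, LinearMap.smul_apply,
    Module.End.one_apply, two_mul, map_add, map_smul, h.K₀_wt, h.Kplus_wt, h.Kminus_wt, J₀_wt,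
    Jplus_wt, Jminus_wt, add_assoc (G := ℤ), sub_add (α := ℤ), sub_sub (α := ℤ),
    add_sub_assoc (G := ℤ), Int.reduceAdd, Int.reduceSub, sub_neg_eq_add, add_zero, sub_zero,
    sub_self, ← sub_eq_add_neg (G := ℤ)]
  push_cast
  match_scalars <;> ring

theorem Jplus_Kplus : Jplus l ρ * Kplus l ρ = Kplus l ρ * Jplus l ρ := by
  refine h.end_ext hN fun s a _ => ?_
  simp only [Module.End.mul_apply, LinearMap.add_apply, LinearMap.sub_apply, LinearMap.smul_apply,
    Module.End.one_apply, two_mul, map_add, map_smul, h.K₀_wt, h.Kplus_wt, h.Kminus_wt, J₀_wt,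
    Jplus_wt, Jminus_wt, add_assoc (G := ℤ), sub_add (α := ℤ), sub_sub (α := ℤ),
    add_sub_assoc (G := ℤ), Int.reduceAdd, Int.reduceSub, sub_neg_eq_add, add_zero, sub_zero,
    sub_self, ← sub_eq_add_neg (G := ℤ)]
  push_cast
  match_scalars <;> ring

theorem Jplus_Kminus : Jplus l ρ * Kminus l ρ = Kminus l ρ * Jplus l ρ + 2 * K₀ l ρ := by
  refine h.end_ext hN fun s a _ => ?_
  simp only [Module.End.mul_apply, LinearMap.add_apply, LinearMap.sub_apply, LinearMap.smul_apply,
    Module.End.one_apply, two_mul, map_add, map_smul, h.K₀_wt, h.Kplus_wt, h.Kminus_wt, J₀_wt,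
    Jplus_wt, Jminus_wt, add_assoc (G := ℤ), sub_add (α := ℤ), sub_sub (α := ℤ),
    add_sub_assoc (G := ℤ), Int.reduceAdd, Int.reduceSub, sub_neg_eq_add, add_zero, sub_zero,
    sub_self, ← sub_eq_add_neg (G := ℤ)]
  push_cast
  match_scalars <;> ring

theorem Jminus_K₀ : Jminus l ρ * K₀ l ρ = K₀ l ρ * Jminus l ρ + Kminus l ρ := by
  refine h.end_ext hN fun s a _ => ?_
  simp only [Module.End.mul_apply, LinearMap.add_apply, LinearMap.sub_apply, LinearMap.smul_apply,
    Module.End.one_apply, two_mul, map_add, map_smul, h.K₀_wt, h.Kplus_wt, h.Kminus_wt, J₀_wt,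
    Jplus_wt, Jminus_wt, add_assoc (G := ℤ), sub_add (α := ℤ), sub_sub (α := ℤ),
    add_sub_assoc (G := ℤ), Int.reduceAdd, Int.reduceSub, sub_neg_eq_add, add_zero, sub_zero,
    sub_self, ← sub_eq_add_neg (G := ℤ)]
  push_cast
  match_scalars <;> ring

theorem Jminus_Kplus : Jminus l ρ * Kplus l ρ = Kplus l ρ * Jminus l ρ - 2 * K₀ l ρ := by
  refine h.end_ext hN fun s a _ => ?_
  simp only [Module.End.mul_apply, LinearMap.add_apply, LinearMap.sub_apply, LinearMap.smul_apply,
    Module.End.one_apply, two_mul, map_add, map_smul, h.K₀_wt, h.Kplus_wt, h.Kminus_wt, J₀_wt,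
    Jplus_wt, Jminus_wt, add_assoc (G := ℤ), sub_add (α := ℤ), sub_sub (α := ℤ),
    add_sub_assoc (G := ℤ), Int.reduceAdd, Int.reduceSub, sub_neg_eq_add, add_zero, sub_zero,
    sub_self, ← sub_eq_add_neg (G := ℤ)]
  push_cast
  match_scalars <;> ring

theorem Jminus_Kminus : Jminus l ρ * Kminus l ρ = Kminus l ρ * Jminus l ρ := by
  refine h.end_ext hN fun s a _ => ?_
  simp only [Module.End.mul_apply, LinearMap.add_apply, LinearMap.sub_apply, LinearMap.smul_apply,
    Module.End.one_apply, two_mul, map_add, map_smul, h.K₀_wt, h.Kplus_wt, h.Kminus_wt, J₀_wt,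
    Jplus_wt, Jminus_wt, add_assoc (G := ℤ), sub_add (α := ℤ), sub_sub (α := ℤ),
    add_sub_assoc (G := ℤ), Int.reduceAdd, Int.reduceSub, sub_neg_eq_add, add_zero, sub_zero,
    sub_self, ← sub_eq_add_neg (G := ℤ)]
  push_cast
  match_scalars <;> ring

theorem K₀_Kplus : K₀ l ρ * Kplus l ρ = Kplus l ρ * K₀ l ρ - Jplus l ρ := by
  refine h.end_ext hN fun s a hs => ?_
  have i1 := hs.pz_succ
  have i2 := hs.pz_pred
  -- For `s = 0` the recursion is unavailable, but spin `0` has a single weight: either the vector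
  -- is zero or `a + 1 = 0`.
  have key : (((a : ℂ) + 1) * (((s : ℂ) + 3) * (pm l ρ (s + 2)) ^ 2 - (s - 1) * (pm l ρ s) ^ 2
      - (pz l ρ s) ^ 2 - 1)) • wt l ρ s (a + 1) = 0 := by
    by_cases h0 : s = 0
    · by_cases h1 : a + 1 = 0
      · have : (a : ℂ) + 1 = 0 := by exact_mod_cast h1
        rw [this, zero_mul, zero_smul]
      · have : invSqrtFact (a + 1) * invSqrtFact (s - (a + 1)) = 0 := by
          rcases lt_or_gt_of_ne h1 with h2 | h2
          · rw [invSqrtFact_of_neg h2, zero_mul]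
          · rw [invSqrtFact_of_neg (a := s - (a + 1)) (by omega), mul_zero]
        rw [wt, mono, this, zero_smul, smul_zero]
    · rw [hs.pm_rec h0, sub_self, mul_zero, zero_smul]
  simp only [Module.End.mul_apply, LinearMap.add_apply, LinearMap.sub_apply, LinearMap.smul_apply,
    Module.End.one_apply, two_mul, map_add, map_smul, h.K₀_wt, h.Kplus_wt, h.Kminus_wt, J₀_wt,
    Jplus_wt, Jminus_wt, add_assoc (G := ℤ), sub_add (α := ℤ), sub_sub (α := ℤ),
    add_sub_assoc (G := ℤ), Int.reduceAdd, Int.reduceSub, sub_neg_eq_add, add_zero, sub_zero,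
    sub_self, ← sub_eq_add_neg (G := ℤ)]
  push_cast
  linear_combination (norm := module) (-1 : ℂ) • key
    + (-(((a : ℂ) + 1) * (a + 2) / 2 * pm l ρ (s + 2)) * i1) • wt l ρ (s + 2) (a + 2)
    + ((1 / 2 : ℂ) * i2) • wt l ρ (s - 2) a

/-- The Jacobi identity: bracket `[K₀, K₊] = -J₊` with `J₋`. Here `[J₋, K₀] = K₋`, while `[K₀, [J₋,
K₊]] = -2[K₀, K₀] = 0`. -/
theorem Kplus_Kminus : Kplus l ρ * Kminus l ρ = Kminus l ρ * Kplus l ρ - 2 * J₀ l ρ := by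
  have e1 := h.Jminus_K₀ hN
  have e2 := h.Jminus_Kplus hN
  have e3 := h.K₀_Kplus hN
  have e4 := h.Jplus_Jminus hN
  linear_combination (norm := noncomm_ring) e1 * Kplus l ρ - Kplus l ρ * e1 + K₀ l ρ * e2
    - e2 * K₀ l ρ - e4 - Jminus l ρ * e3 + e3 * Jminus l ρ

/-- The Jacobi identity again: the bracket of `[K₊, K₋] = -2J₀` with `J₋` gives twice the claim. -/
theorem K₀_Kminus : K₀ l ρ * Kminus l ρ = Kminus l ρ * K₀ l ρ + Jminus l ρ := by
  have e2 := h.Jminus_Kplus hN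
  have e5 := h.Kplus_Kminus hN
  have e6 := h.Jminus_Kminus hN
  have e7 := h.J₀_Jminus hN
  refine smul_right_injective _ (two_ne_zero (α := ℂ)) ?_
  simp only [two_smul]
  linear_combination (norm := noncomm_ring) e2 * Kminus l ρ - Kminus l ρ * e2 + Kplus l ρ * e6
    - e6 * Kplus l ρ - e7 - e7 - Jminus l ρ * e5 + e5 * Jminus l ρ

theorem casimir_JK : J₀ l ρ * K₀ l ρ + (1 / 2 : ℂ) • (Jplus l ρ * Kminus l ρ + Jminus l ρ * Kplus l ρ) =
    (Complex.I * l * ρ) • 1 := by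
  refine h.end_ext hN fun s a hs => ?_
  have i1 := hs.pz_mul
  simp only [Module.End.mul_apply, LinearMap.add_apply, LinearMap.sub_apply, LinearMap.smul_apply,
    Module.End.one_apply, two_mul, map_add, map_smul, h.K₀_wt, h.Kplus_wt, h.Kminus_wt, J₀_wt,
    Jplus_wt, Jminus_wt, add_assoc (G := ℤ), sub_add (α := ℤ), sub_sub (α := ℤ),
    add_sub_assoc (G := ℤ), Int.reduceAdd, Int.reduceSub, sub_neg_eq_add, add_zero, sub_zero,
    sub_self, ← sub_eq_add_neg (G := ℤ)]
  push_cast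
  linear_combination (norm := module) ((1 / 4 : ℂ) * i1) • wt l ρ s a

theorem casimir_JJKK : J₀ l ρ * J₀ l ρ + (1 / 2 : ℂ) • (Jplus l ρ * Jminus l ρ + Jminus l ρ * Jplus l ρ) -
    (K₀ l ρ * K₀ l ρ + (1 / 2 : ℂ) • (Kplus l ρ * Kminus l ρ + Kminus l ρ * Kplus l ρ)) =
    ((l : ℂ) ^ 2 + ρ ^ 2 - 1) • 1 := by
  refine h.end_ext hN fun s a hs => ?_
  have i3 := hs.pm_casimir
  simp only [Module.End.mul_apply, LinearMap.add_apply, LinearMap.sub_apply, LinearMap.smul_apply,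
    Module.End.one_apply, two_mul, map_add, map_smul, h.K₀_wt, h.Kplus_wt, h.Kminus_wt, J₀_wt,
    Jplus_wt, Jminus_wt, add_assoc (G := ℤ), sub_add (α := ℤ), sub_sub (α := ℤ),
    add_sub_assoc (G := ℤ), Int.reduceAdd, Int.reduceSub, sub_neg_eq_add, add_zero, sub_zero,
    sub_self, ← sub_eq_add_neg (G := ℤ)]
  push_cast
  linear_combination (norm := module) ((1 / 4 : ℂ) * i3) • wt l ρ s a

end Unbounded
end Irreducible

namespace Triple

variable {A : Type*} [Ring A] [Algebra ℂ A]

theorem IsSl2.casimir_eq {T : Triple A} (h : IsSl2 T) :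
    T.casimir = T.h * T.h + (1 / 2 : ℂ) • (T.e * T.f + T.f * T.e) := by
  have := h.ef
  rw [two_mul] at this
  rw [casimir]
  linear_combination (norm := module) (-1 / 2 : ℂ) • this

end Triple

/-! ### The two commuting copies of `sl₂` acting on `V`. -/

section Irreducible
variable {l : ℚ} {ρ : ℂ}

variable (l ρ) in
/-- The combination `(J + εK) / 2`; for `ε = ± i` these are the two commuting copies of `sl₂`. -/
def chiral (ε : ℂ) : Triple (Module.End ℂ (Space l ρ)) where
  h := (1 / 2 : ℂ) • (J₀ l ρ + ε • K₀ l ρ)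
  e := (1 / 2 : ℂ) • (Jplus l ρ + ε • Kplus l ρ)
  f := (1 / 2 : ℂ) • (Jminus l ρ + ε • Kminus l ρ)

namespace Unbounded
variable (h : Unbounded l ρ) {N : ℕ} (hN : |l| = N / 2) {ε : ℂ} (hε : ε * ε = -1)
include h hN hε

theorem isSl2_chiral : (chiral l ρ ε).IsSl2 := by
  have r1 := h.J₀_Jplus hN
  have r2 := h.J₀_Jminus hN
  have r3 := h.Jplus_Jminus hN
  have r4 := h.J₀_Kplus hN
  have r5 := h.J₀_Kminus hN
  have r6 := h.Jplus_K₀ hN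
  have r7 := h.Jplus_Kminus hN
  have r8 := h.Jminus_K₀ hN
  have r9 := h.Jminus_Kplus hN
  have r10 := h.K₀_Kplus hN
  have r11 := h.Kplus_Kminus hN
  have r12 := h.K₀_Kminus hN
  constructor <;> simp only [chiral, smul_mul_assoc, mul_smul_comm, mul_add, add_mul, smul_add,
    smul_smul, two_mul] at *
  · linear_combination (norm := module) (1 / 4 : ℂ) • r1 + (ε / 4) • r4 - (ε / 4) • r6
      + (ε * ε / 4) • r10 - ((1 / 4 : ℂ) * hε) • Jplus l ρ
  · linear_combination (norm := module) (1 / 4 : ℂ) • r2 + (ε / 4) • r5 - (ε / 4) • r8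
      + (ε * ε / 4) • r12 + ((1 / 4 : ℂ) * hε) • Jminus l ρ
  · linear_combination (norm := module) (1 / 4 : ℂ) • r3 + (ε / 4) • r7 - (ε / 4) • r9
      + (ε * ε / 4) • r11 - ((1 / 2 : ℂ) * hε) • J₀ l ρ

theorem commutes_chiral : (chiral l ρ ε).Commutes (chiral l ρ (-ε)) := by
  have r1 := h.J₀_Jplus hN
  have r2 := h.J₀_Jminus hN
  have r3 := h.Jplus_Jminus hN
  have r0 := h.J₀_K₀ hN
  have r4 := h.J₀_Kplus hN
  have r5 := h.J₀_Kminus hN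
  have r6 := h.Jplus_K₀ hN
  have r6' := h.Jplus_Kplus hN
  have r7 := h.Jplus_Kminus hN
  have r8 := h.Jminus_K₀ hN
  have r9 := h.Jminus_Kplus hN
  have r9' := h.Jminus_Kminus hN
  have r10 := h.K₀_Kplus hN
  have r11 := h.Kplus_Kminus hN
  have r12 := h.K₀_Kminus hN
  constructor <;> simp only [chiral, smul_mul_assoc, mul_smul_comm, mul_add, add_mul, smul_add,
    smul_smul, two_mul] at *
  · linear_combination (norm := module) (-ε / 2) • r0
  · linear_combination (norm := module) (1 / 4 : ℂ) • r1 - (ε / 4) • r4 - (ε / 4) • r6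
      - (ε * ε / 4) • r10 + ((1 / 4 : ℂ) * hε) • Jplus l ρ
  · linear_combination (norm := module) (1 / 4 : ℂ) • r2 - (ε / 4) • r5 - (ε / 4) • r8
      - (ε * ε / 4) • r12 - ((1 / 4 : ℂ) * hε) • Jminus l ρ
  · linear_combination (norm := module) (-1 / 4 : ℂ) • r1 - (ε / 4) • r4 - (ε / 4) • r6
      + (ε * ε / 4) • r10 - ((1 / 4 : ℂ) * hε) • Jplus l ρ
  · linear_combination (norm := module) (-ε / 2) • r6'
  · linear_combination (norm := module) (1 / 4 : ℂ) • r3 - (ε / 4) • r7 - (ε / 4) • r9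
      - (ε * ε / 4) • r11 + ((1 / 2 : ℂ) * hε) • J₀ l ρ
  · linear_combination (norm := module) (-1 / 4 : ℂ) • r2 - (ε / 4) • r5 - (ε / 4) • r8
      + (ε * ε / 4) • r12 + ((1 / 4 : ℂ) * hε) • Jminus l ρ
  · linear_combination (norm := module) (-1 / 4 : ℂ) • r3 - (ε / 4) • r7 - (ε / 4) • r9
      + (ε * ε / 4) • r11 - ((1 / 2 : ℂ) * hε) • J₀ l ρ
  · linear_combination (norm := module) (-ε / 2) • r9'

/-- For `ε = ± i` the numerator is `(λ ∓ ρ)² - 1`, a perfect square minus one, which is the shape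
required by `Coupled`. -/
theorem casimir_chiral : (chiral l ρ ε).casimir =
    (((l : ℂ) ^ 2 + ρ ^ 2 - 1 + 2 * ε * (Complex.I * l * ρ)) / 4) • 1 := by
  have c1 := h.casimir_JK hN
  have c2 := h.casimir_JJKK hN
  have r0 := h.J₀_K₀ hN
  have r7 := h.Jplus_Kminus hN
  have r9 := h.Jminus_Kplus hN
  rw [(h.isSl2_chiral hN hε).casimir_eq]
  simp only [chiral, smul_mul_assoc, mul_smul_comm, mul_add, add_mul, smul_add,
    smul_smul, two_mul] at *
  linear_combination (norm := module) (1 / 4 : ℂ) • c2 + (ε / 2) • c1 - (ε / 4) • r0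
    - (ε / 8) • r7 - (ε / 8) • r9 + ((1 / 4 : ℂ) * hε) • (K₀ l ρ * K₀ l ρ)
    + ((1 / 8 : ℂ) * hε) • (Kplus l ρ * Kminus l ρ) + ((1 / 8 : ℂ) * hε) • (Kminus l ρ * Kplus l ρ)

-- `wt s 0` has `m = -j`: `J₋` kills it, and no vector of spin `j` or `j - 1` has weight `-j - 1`.
-- Only the spin-raising term of `K₋` survives.
omit hN hε in
theorem chiral_f_wt_zero (s : ℤ) : (chiral l ρ ε).f (wt l ρ s 0) =
    (ε / 2 * (s + 1) * (s + 2) * pm l ρ (s + 2)) • wt l ρ (s + 2) 0 := by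
  have e1 : ∀ t a : ℤ, a < 0 → wt l ρ t a = 0 := fun t a ha => by
    rw [wt, mono, invSqrtFact_of_neg ha, zero_mul, zero_smul]
  simp only [chiral, LinearMap.smul_apply, LinearMap.add_apply, Jminus_wt, h.Kminus_wt,
    e1 _ (0 - 1) (by omega), e1 _ (0 - 2) (by omega)]
  push_cast
  module

-- Infinite dimension enters here: `P⁺` never vanishes on the ladder, so the powers of `f` never
-- kill the vector.
omit hε in
theorem chiral_f_pow_wt_zero (hε' : ε ≠ 0) (k n : ℕ) :
    ∃ c : ℂ, c ≠ 0 ∧ ((chiral l ρ ε).f ^ k) (wt l ρ (N + 2 * n) 0) =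
      c • wt l ρ (N + 2 * (n + k : ℕ)) 0 := by
  induction k with
  | zero => exact ⟨1, one_ne_zero, by simp⟩
  | succ k ih =>
    obtain ⟨c, hc, e⟩ := ih
    have hp : pm l ρ (N + 2 * (n + k : ℕ) + 2) ≠ 0 := by
      have := h (n + k)
      rw [Pplus] at this
      rw [pm]
      convert this using 2
      rw [hN]; push_cast; ring
    refine ⟨c * (ε / 2 * (((N + 2 * (n + k : ℕ) : ℤ) : ℂ) + 1) * (((N + 2 * (n + k : ℕ) : ℤ) : ℂ) + 2)
      * pm l ρ (N + 2 * (n + k : ℕ) + 2)), ?_, ?_⟩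
    · refine mul_ne_zero hc (mul_ne_zero (mul_ne_zero (mul_ne_zero ?_ ?_) ?_) hp)
      · exact div_ne_zero hε' two_ne_zero
      · exact_mod_cast (by omega : (N : ℤ) + 2 * (n + k : ℕ) + 1 ≠ 0)
      · exact_mod_cast (by omega : (N : ℤ) + 2 * (n + k : ℕ) + 2 ≠ 0)
    · rw [pow_succ', Module.End.mul_apply, e, map_smul, h.chiral_f_wt_zero, smul_smul]
      congr 2

omit hε in
theorem wt_zero_ne_zero (n : ℕ) : wt l ρ (N + 2 * n) 0 ≠ 0 := by
  have hs : ((((0 : ℤ) : ℚ) + ((N + 2 * n - 0 : ℤ) : ℚ)) / 2) ∈ spins l ρ :=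
    h.mem_spins_iff.mpr ⟨n, by push_cast; rw [hN]; ring⟩
  have hm := (mem_magnetic_iff (a := 0) (b := N + 2 * n - 0) rfl).mpr ⟨le_rfl, by omega⟩
  rw [wt, mono, ket, dif_pos ⟨hs, hm⟩]
  refine smul_ne_zero (mul_ne_zero (invSqrtFact_ne_zero le_rfl) (invSqrtFact_ne_zero (by omega))) ?_
  simp

end Unbounded

/-- A zero of `P⁺` at `|λ| + k` leaves at most `k + 1` spins, each with finitely many weights. -/
theorem unbounded_of_not_finiteDimensional (h : ¬ FiniteDimensional ℂ (Space l ρ)) :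
    Unbounded l ρ := by
  intro k hk
  refine h ?_
  have hspin : (spins l ρ).Finite := by
    refine (Set.finite_range fun n : Fin (k + 1) => |l| + ((n : ℕ) : ℚ)).subset ?_
    rintro j ⟨n, hn, hn'⟩
    have : n ≤ k := by
      by_contra hlt
      exact hn' k (by omega) hk
    exact ⟨⟨n, by omega⟩, hn.symm⟩
  have hmag : ∀ j : ℚ, (magnetic j).Finite := fun j => by
    refine (Set.finite_range fun n : Fin (⌈2 * j⌉₊ + 1) => -j + ((n : ℕ) : ℚ)).subset ?_
    rintro m ⟨n, hn, hn'⟩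
    have : (n : ℚ) ≤ 2 * j := by linarith
    have : n ≤ ⌈2 * j⌉₊ := by exact_mod_cast this.trans (Nat.le_ceil _)
    exact ⟨⟨n, by omega⟩, hn.symm⟩
  have : ({p : ℚ × ℚ | p.1 ∈ spins l ρ ∧ p.2 ∈ magnetic p.1}).Finite := by
    refine (hspin.biUnion fun j _ => (Set.finite_singleton j).prod (hmag j)).subset ?_
    rintro ⟨j, m⟩ ⟨hj, hm⟩
    exact Set.mem_biUnion hj ⟨rfl, hm⟩
  have : Finite (Labels l ρ) := this
  infer_instance

theorem Unbounded.not_finiteDimensional (h : Unbounded l ρ) :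
    ¬ FiniteDimensional ℂ (Space l ρ) := by
  intro hf
  have hfin : Finite (Labels l ρ) :=
    Module.Finite.finite_basis (Finsupp.basisSingleOne (R := ℂ) (ι := Labels l ρ))
  have hl : (0 : ℚ) ≤ |l| := abs_nonneg l
  refine not_injective_infinite_finite (fun n : ℕ => (⟨(|l| + n, -(|l| + n)),
    ⟨n, rfl, fun k _ => h k⟩, 0, by simp, by
      have : (0 : ℚ) ≤ n := n.cast_nonneg
      linarith⟩ : Labels l ρ)) fun m n hmn => ?_
  have := congrArg (fun p : Labels l ρ => p.1.1) hmn
  simpa using this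

end Irreducible

/-! ### The spin-`n/2` modules. -/

section Spin

/-- The ladder operators `J₀, J₊, J₋` of the spin-`γ` module. -/
def spinTriple (γ : ℚ) : Triple (Module.End ℂ (SpinSpace γ)) where
  h := Finsupp.linearCombination ℂ fun μ : magnetic γ => ((μ : ℚ) : ℂ) • spinKet γ μ
  e := Finsupp.linearCombination ℂ fun μ : magnetic γ => Cp γ μ • spinKet γ (μ + 1)
  f := Finsupp.linearCombination ℂ fun μ : magnetic γ => Cm γ μ • spinKet γ (μ - 1)

/-- The rescaled basis vector `|γ,μ⟩ / √((γ+μ)! (γ-μ)!)` with `γ + μ = a` and `2γ = n`. -/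
def spinWt (n : ℕ) (a : ℤ) : SpinSpace ((n : ℚ) / 2) :=
  (invSqrtFact a * invSqrtFact (n - a)) • spinKet ((n : ℚ) / 2) (a - n / 2)

variable {n : ℕ}

theorem mem_magnetic_half_iff {a : ℤ} :
    (a : ℚ) - n / 2 ∈ magnetic ((n : ℚ) / 2) ↔ 0 ≤ a ∧ a ≤ n := by
  have := mem_magnetic_iff (j := (n : ℚ) / 2) (a := a) (b := n - a) (by push_cast; ring)
  rw [show ((a : ℚ) - ((n - a : ℤ) : ℚ)) / 2 = a - n / 2 by push_cast; ring] at this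
  rw [this]
  omega

theorem linearCombination_spinWt (g : ℚ → SpinSpace ((n : ℚ) / 2)) (a : ℤ) :
    Finsupp.linearCombination ℂ (fun μ : magnetic ((n : ℚ) / 2) => g μ) (spinWt n a) =
      (invSqrtFact a * invSqrtFact (n - a)) • g (a - n / 2) := by
  by_cases h : 0 ≤ a ∧ a ≤ n
  · rw [spinWt, map_smul, spinKet, dif_pos (mem_magnetic_half_iff.mpr h),
      Finsupp.linearCombination_single, one_smul]
  · have : invSqrtFact a * invSqrtFact (n - a) = 0 := by
      rcases not_and_or.mp h with h | h
      · rw [invSqrtFact_of_neg (by omega), zero_mul]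
      · rw [invSqrtFact_of_neg (a := n - a) (by omega), mul_zero]
    rw [spinWt, this, zero_smul, zero_smul, map_zero]

theorem spin_h_wt (a : ℤ) : (spinTriple ((n : ℚ) / 2)).h (spinWt n a) =
    ((a : ℂ) - n / 2) • spinWt n a := by
  rw [spinTriple, linearCombination_spinWt fun μ => (μ : ℂ) • spinKet ((n : ℚ) / 2) μ, smul_comm,
    spinWt]
  push_cast; rfl

theorem spin_e_wt (a : ℤ) : (spinTriple ((n : ℚ) / 2)).e (spinWt n a) =
    ((a : ℂ) + 1) • spinWt n (a + 1) := by
  rw [spinTriple, linearCombination_spinWt fun μ => Cp (n / 2) μ • spinKet ((n : ℚ) / 2) (μ + 1),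
    spinWt, smul_smul, smul_smul]
  have e1 := invSqrtFact_mul_rsqrt (n - a)
  rw [show (n : ℤ) - a - 1 = n - (a + 1) by ring] at e1
  push_cast at e1 ⊢
  rw [Cp, show (n : ℚ) / 2 - (a - n / 2) = n - a by ring,
    show (n : ℚ) / 2 + (a - n / 2) + 1 = a + 1 by ring,
    show (a : ℚ) - n / 2 + 1 = a + 1 - n / 2 by ring, ← e1]
  congr 1
  linear_combination invSqrtFact (n - a) * rsqrt (n - a) * invSqrtFact_mul_rsqrt_succ a

theorem spin_f_wt (a : ℤ) : (spinTriple ((n : ℚ) / 2)).f (spinWt n a) =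
    ((n : ℂ) - a + 1) • spinWt n (a - 1) := by
  rw [spinTriple, linearCombination_spinWt fun μ => Cm (n / 2) μ • spinKet ((n : ℚ) / 2) (μ - 1),
    spinWt, smul_smul, smul_smul]
  have e1 := invSqrtFact_mul_rsqrt_succ (n - a)
  rw [show (n : ℤ) - a + 1 = n - (a - 1) by ring] at e1
  push_cast at e1 ⊢
  rw [Cm, show (n : ℚ) / 2 - (a - n / 2) + 1 = n - a + 1 by ring,
    show (n : ℚ) / 2 + (a - n / 2) = a by ring,
    show (a : ℚ) - n / 2 - 1 = a - 1 - n / 2 by ring, ← invSqrtFact_mul_rsqrt]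
  congr 1
  linear_combination invSqrtFact a * rsqrt a * e1

theorem spinWt_eq_zero {a : ℤ} (h : ¬ (0 ≤ a ∧ a ≤ n)) : spinWt n a = 0 := by
  rw [spinWt, spinKet, dif_neg fun h' => h (mem_magnetic_half_iff.mp h'), smul_zero]

theorem spinWt_zero_ne_zero : spinWt n 0 ≠ 0 := by
  rw [spinWt, spinKet, dif_pos (mem_magnetic_half_iff.mpr ⟨le_rfl, by omega⟩)]
  refine smul_ne_zero (mul_ne_zero (invSqrtFact_ne_zero le_rfl) (invSqrtFact_ne_zero (by omega))) ?_
  simp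

theorem spinWt_span (W : Submodule ℂ (SpinSpace ((n : ℚ) / 2))) (h : ∀ a : ℕ, spinWt n a ∈ W) :
    W = ⊤ := by
  refine eq_top_iff.mpr ?_
  rw [← (Finsupp.basisSingleOne (R := ℂ) (ι := magnetic ((n : ℚ) / 2))).span_eq, Submodule.span_le]
  rintro _ ⟨⟨μ, hμ⟩, rfl⟩
  obtain ⟨k, hk, hk'⟩ := id hμ
  have hk2 : k ≤ n := by
    have : (k : ℚ) ≤ n := by linarith
    exact_mod_cast this
  have e : spinKet ((n : ℚ) / 2) μ =
      (invSqrtFact k * invSqrtFact (n - k))⁻¹ • spinWt n k := by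
    rw [spinWt, smul_smul, inv_mul_cancel₀ (mul_ne_zero (invSqrtFact_ne_zero (by omega))
      (invSqrtFact_ne_zero (by omega))), one_smul, hk]
    congr 1; push_cast; ring
  have e' : Finsupp.basisSingleOne (R := ℂ) ⟨μ, hμ⟩ = spinKet ((n : ℚ) / 2) μ := by
    rw [spinKet, dif_pos hμ]; rfl
  rw [e', e]
  exact W.smul_mem _ (h k)

theorem spin_ext {f g : Module.End ℂ (SpinSpace ((n : ℚ) / 2))}
    (h : ∀ a : ℤ, f (spinWt n a) = g (spinWt n a)) : f = g := by
  have := spinWt_span (LinearMap.ker (f - g)) fun a => by simp [h]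
  exact sub_eq_zero.mp (LinearMap.ker_eq_top.mp this)

theorem isSl2_spinTriple : (spinTriple ((n : ℚ) / 2)).IsSl2 := by
  constructor <;> refine spin_ext fun a => ?_ <;>
    simp only [Module.End.mul_apply, LinearMap.add_apply, LinearMap.sub_apply, two_mul, map_smul,
      spin_h_wt, spin_e_wt, spin_f_wt, add_sub_cancel_right, sub_add_cancel] <;>
    push_cast <;> module

theorem spin_e_pow (i : ℕ) : ((spinTriple ((n : ℚ) / 2)).e ^ i) (spinWt n 0) =
    (i.factorial : ℂ) • spinWt n i := by
  induction i with
  | zero => simp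
  | succ i ih =>
    rw [pow_succ', Module.End.mul_apply, ih, map_smul, spin_e_wt, smul_smul, Nat.factorial_succ]
    push_cast
    rw [mul_comm]

theorem spin_e_pow_span (W : Submodule ℂ (SpinSpace ((n : ℚ) / 2)))
    (h : ∀ i : ℕ, ((spinTriple ((n : ℚ) / 2)).e ^ i) (spinWt n 0) ∈ W) : W = ⊤ := by
  refine spinWt_span W fun i => ?_
  have := h i
  rwa [spin_e_pow, Submodule.smul_mem_iff _ (by exact_mod_cast i.factorial_ne_zero)] at this

theorem spin_e_pow_eq_zero : (spinTriple ((n : ℚ) / 2)).e ^ (n + 1) = 0 := by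
  have key : ∀ (i : ℕ) (a : ℤ), ∃ c : ℂ,
      ((spinTriple ((n : ℚ) / 2)).e ^ i) (spinWt n a) = c • spinWt n (a + i) := by
    intro i a
    induction i with
    | zero => exact ⟨1, by simp⟩
    | succ i ih =>
      obtain ⟨c, hc⟩ := ih
      refine ⟨c * (((a + i : ℤ) : ℂ) + 1), ?_⟩
      rw [pow_succ', Module.End.mul_apply, hc, map_smul, spin_e_wt, smul_smul]
      congr 2; push_cast; ring
  refine spin_ext fun a => ?_
  obtain ⟨c, hc⟩ := key (n + 1) a
  by_cases h : 0 ≤ a ∧ a ≤ n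
  · rw [hc, spinWt_eq_zero (by push_cast; omega), smul_zero, LinearMap.zero_apply]
  · rw [spinWt_eq_zero h, map_zero, map_zero]

theorem low_spinWt : (spinTriple ((n : ℚ) / 2)).Low n (spinWt n 0) := by
  constructor
  · rw [spin_f_wt, spinWt_eq_zero (by omega), smul_zero]
  · rw [spin_h_wt]; congr 1; push_cast; ring

end Spin

theorem tmul_ne_zero {M M' : Type} [AddCommGroup M] [Module ℂ M] [AddCommGroup M'] [Module ℂ M']
    {x : M} {y : M'} (hx : x ≠ 0) (hy : y ≠ 0) : x ⊗ₜ[ℂ] y ≠ 0 := by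
  obtain ⟨f, hf⟩ := not_forall.mp (mt (Module.forall_dual_apply_eq_zero_iff ℂ x).mp hx)
  obtain ⟨g, hg⟩ := not_forall.mp (mt (Module.forall_dual_apply_eq_zero_iff ℂ y).mp hy)
  intro h
  have := congrArg (LinearMap.mul' ℂ ℂ ∘ₗ TensorProduct.map f g) h
  simp [hf, hg] at this

namespace Triple

variable {A B : Type*} [Ring A] [Ring B] [Algebra ℂ A] [Algebra ℂ B]

/-- The image of a triple under a homomorphism of algebras. -/
def map (φ : A →ₐ[ℂ] B) (T : Triple A) : Triple B := ⟨φ T.h, φ T.e, φ T.f⟩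

theorem IsSl2.map {T : Triple A} (h : IsSl2 T) (φ : A →ₐ[ℂ] B) : IsSl2 (T.map φ) := by
  constructor
  · simpa [Triple.map] using congrArg φ h.he
  · simpa [Triple.map] using congrArg φ h.hf
  · simpa [Triple.map, map_ofNat] using congrArg φ h.ef

theorem Commutes.map {S T : Triple A} (h : Commutes S T) (φ : A →ₐ[ℂ] B) :
    Commutes (S.map φ) (T.map φ) := by
  constructor <;> simp only [Triple.map, ← map_mul, h.hh, h.he, h.hf, h.eh, h.ee, h.ef, h.fh, h.fe,
    h.ff]

theorem commutes_map_map {A' : Type*} [Ring A'] [Algebra ℂ A'] {φ : A →ₐ[ℂ] B} {ψ : A' →ₐ[ℂ] B}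
    (h : ∀ x y, φ x * ψ y = ψ y * φ x) (S : Triple A) (T : Triple A') :
    Commutes (S.map φ) (T.map ψ) :=
  ⟨h _ _, h _ _, h _ _, h _ _, h _ _, h _ _, h _ _, h _ _, h _ _⟩

theorem casimir_map (φ : A →ₐ[ℂ] B) (T : Triple A) : (T.map φ).casimir = φ T.casimir := by
  simp [casimir, map]

end Triple

/-! ### From the Lorentz Casimirs to those of two commuting triples. -/

section Casimirs

variable {U : Type} [AddCommGroup U] [Module ℂ U]

theorem sum_ofLadder (x xp xm y yp ym : Module.End ℂ U) :
    ∑ a, ofLadder x xp xm a * ofLadder y yp ym a = x * y + (1 / 2 : ℂ) • (xp * ym + xm * yp) := by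
  have e : (1 / (2 * Complex.I)) * (1 / (2 * Complex.I)) = -1 / 4 := by
    rw [div_mul_div_comm, show (2 * Complex.I) * (2 * Complex.I) = 4 * (Complex.I * Complex.I) by
      ring, Complex.I_mul_I]
    norm_num
  simp only [Fin.sum_univ_three, ofLadder, Matrix.cons_val_zero, Matrix.cons_val_one,
    Matrix.cons_val, smul_mul_assoc, mul_smul_comm, mul_add, add_mul, mul_sub, sub_mul]
  linear_combination (norm := module) e • (xp * yp - xp * ym - xm * yp + xm * ym)

/-- The action in which two commuting triples `A`, `B` are the left and right copies of `sl₂`. -/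
def Action.ofTriples (A B : Triple (Module.End ℂ U)) : Action U where
  J := ofLadder (A.h + B.h) (A.e + B.e) (A.f + B.f)
  K := ofLadder (-Complex.I • (A.h - B.h)) (-Complex.I • (A.e - B.e)) (-Complex.I • (A.f - B.f))

theorem Action.ofTriples_add (S R : Triple (Module.End ℂ U)) (j jp jm k kp km : Module.End ℂ U) :
    Action.ofTriples
      (S.add ⟨(1 / 2 : ℂ) • (j + Complex.I • k), (1 / 2 : ℂ) • (jp + Complex.I • kp),
        (1 / 2 : ℂ) • (jm + Complex.I • km)⟩)
      (R.add ⟨(1 / 2 : ℂ) • (j + (-Complex.I) • k), (1 / 2 : ℂ) • (jp + (-Complex.I) • kp),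
        (1 / 2 : ℂ) • (jm + (-Complex.I) • km)⟩) =
    ⟨ofLadder (S.h + R.h + j) (S.e + R.e + jp) (S.f + R.f + jm),
      ofLadder (-Complex.I • S.h + Complex.I • R.h + k) (-Complex.I • S.e + Complex.I • R.e + kp)
        (-Complex.I • S.f + Complex.I • R.f + km)⟩ := by
  have e := Complex.I_mul_I
  rw [Action.ofTriples]
  simp only [Triple.add]
  congr 2
  · module
  · module
  · module
  · linear_combination (norm := module) (-e) • k
  · linear_combination (norm := module) (-e) • kp
  · linear_combination (norm := module) (-e) • km

variable {A B : Triple (Module.End ℂ U)} (hA : A.IsSl2) (hB : B.IsSl2) (hAB : A.Commutes B)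
include hA hB hAB

theorem casimir₁_ofTriples :
    (Action.ofTriples A B).casimir₁ = -Complex.I • (A.casimir - B.casimir) := by
  rw [Action.casimir₁, Action.ofTriples, sum_ofLadder, hA.casimir_eq, hB.casimir_eq]
  simp only [mul_smul_comm, mul_sub, add_mul, ← hAB.hh, ← hAB.ef, ← hAB.fe]
  module

theorem casimir₂_ofTriples :
    (Action.ofTriples A B).casimir₂ = (2 : ℂ) • (A.casimir + B.casimir) := by
  rw [Action.casimir₂, Action.ofTriples, sum_ofLadder, sum_ofLadder, hA.casimir_eq, hB.casimir_eq]
  simp only [mul_smul_comm, smul_mul_assoc, mul_sub, sub_mul, mul_add, add_mul, ← hAB.hh, ← hAB.ef,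
    ← hAB.fe]
  linear_combination (norm := module) (-1 : ℂ) • Complex.I_mul_I • (A.h * A.h + B.h * B.h
    - (2 : ℂ) • (A.h * B.h) + (1 / 2 : ℂ) • (A.e * A.f + A.f * A.e + B.e * B.f + B.f * B.e)
    - A.e * B.f - A.f * B.e)

theorem isJointEigen_ofTriples_iff {c : ℂ × ℂ} {v : U} :
    IsJointEigen (Action.ofTriples A B).casimir₁ (Action.ofTriples A B).casimir₂ c v ↔
      IsJointEigen A.casimir B.casimir
        ((c.2 + 2 * Complex.I * c.1) / 4, (c.2 - 2 * Complex.I * c.1) / 4) v := by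
  rw [IsJointEigen, IsJointEigen, casimir₁_ofTriples hA hB hAB, casimir₂_ofTriples hA hB hAB]
  simp only [LinearMap.smul_apply, LinearMap.add_apply, LinearMap.sub_apply]
  have e := Complex.I_mul_I
  constructor
  · rintro ⟨h1, h2⟩
    constructor
    · linear_combination (norm := module) (Complex.I / 2) • h1 + (1 / 4 : ℂ) • h2
        + ((1 / 2 : ℂ) * e) • (A.casimir v - B.casimir v)
    · linear_combination (norm := module) (-Complex.I / 2) • h1 + (1 / 4 : ℂ) • h2
        - ((1 / 2 : ℂ) * e) • (A.casimir v - B.casimir v)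
  · rintro ⟨h1, h2⟩
    constructor
    · linear_combination (norm := module) (-Complex.I) • h1 + Complex.I • h2
        - (c.1 * e) • v
    · linear_combination (norm := module) (2 : ℂ) • h1 + (2 : ℂ) • h2

/-- The passage from `(C₁, C₂)` to the two `sl₂` Casimirs is an invertible linear change, so the
same basis serves both pairs. -/
theorem simultaneouslyDiagonalisable_ofTriples_iff :
    SimultaneouslyDiagonalisable (Action.ofTriples A B).casimir₁ (Action.ofTriples A B).casimir₂ ↔
      SimultaneouslyDiagonalisable A.casimir B.casimir := by
  have e := Complex.I_mul_I
  refine exists_congr fun ι => exists_congr fun b => forall_congr' fun i => ⟨?_, ?_⟩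
  · rintro ⟨c, hc⟩
    exact ⟨_, (isJointEigen_ofTriples_iff hA hB hAB).mp hc⟩
  · rintro ⟨c, hc⟩
    refine ⟨(-Complex.I * (c.1 - c.2), 2 * (c.1 + c.2)),
      (isJointEigen_ofTriples_iff hA hB hAB).mpr ?_⟩
    convert hc using 1
    refine Prod.ext ?_ ?_
    · simp only; linear_combination (-1 / 2) * (c.1 - c.2) * e
    · simp only; linear_combination (1 / 2) * (c.1 - c.2) * e

theorem mem_jointEigenvalues_ofTriples_iff {c : ℂ × ℂ} :
    c ∈ jointEigenvalues (Action.ofTriples A B).casimir₁ (Action.ofTriples A B).casimir₂ ↔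
      ((c.2 + 2 * Complex.I * c.1) / 4, (c.2 - 2 * Complex.I * c.1) / 4) ∈
        jointEigenvalues A.casimir B.casimir :=
  exists_congr fun _ => and_congr_right fun _ => isJointEigen_ofTriples_iff hA hB hAB

end Casimirs

/-! ### Operators on the factors of a triple tensor product. -/

section Tensor

variable (X Y Z : Type) [AddCommGroup X] [Module ℂ X] [AddCommGroup Y] [Module ℂ Y]
  [AddCommGroup Z] [Module ℂ Z]

/-- Operators acting on the first factor of a triple tensor product. -/
def onLeft : Module.End ℂ X →ₐ[ℂ] Module.End ℂ ((X ⊗[ℂ] Y) ⊗[ℂ] Z) :=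
  (Module.End.rTensorAlgHom ℂ (X ⊗[ℂ] Y) Z).comp (Module.End.rTensorAlgHom ℂ X Y)

/-- Operators acting on the second factor of a triple tensor product. -/
def onMiddle : Module.End ℂ Y →ₐ[ℂ] Module.End ℂ ((X ⊗[ℂ] Y) ⊗[ℂ] Z) :=
  (Module.End.rTensorAlgHom ℂ (X ⊗[ℂ] Y) Z).comp (Module.End.lTensorAlgHom ℂ Y X)

/-- Operators acting on the third factor of a triple tensor product. -/
def onRight : Module.End ℂ Z →ₐ[ℂ] Module.End ℂ ((X ⊗[ℂ] Y) ⊗[ℂ] Z) :=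
  Module.End.lTensorAlgHom ℂ Z (X ⊗[ℂ] Y)

variable {X Y Z}

theorem onLeft_apply (f : Module.End ℂ X) (x : X) (y : Y) (z : Z) :
    onLeft X Y Z f ((x ⊗ₜ y) ⊗ₜ z) = (f x ⊗ₜ y) ⊗ₜ z := rfl

theorem onMiddle_apply (f : Module.End ℂ Y) (x : X) (y : Y) (z : Z) :
    onMiddle X Y Z f ((x ⊗ₜ y) ⊗ₜ z) = (x ⊗ₜ f y) ⊗ₜ z := rfl

theorem onRight_apply (f : Module.End ℂ Z) (x : X) (y : Y) (z : Z) :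
    onRight X Y Z f ((x ⊗ₜ y) ⊗ₜ z) = (x ⊗ₜ y) ⊗ₜ f z := rfl

theorem onLeft_mul_onMiddle (f : Module.End ℂ X) (g : Module.End ℂ Y) :
    onLeft X Y Z f * onMiddle X Y Z g = onMiddle X Y Z g * onLeft X Y Z f :=
  TensorProduct.ext_threefold fun _ _ _ => rfl

theorem onLeft_mul_onRight (f : Module.End ℂ X) (g : Module.End ℂ Z) :
    onLeft X Y Z f * onRight X Y Z g = onRight X Y Z g * onLeft X Y Z f :=
  TensorProduct.ext_threefold fun _ _ _ => rfl

theorem onMiddle_mul_onRight (f : Module.End ℂ Y) (g : Module.End ℂ Z) :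
    onMiddle X Y Z f * onRight X Y Z g = onRight X Y Z g * onMiddle X Y Z f :=
  TensorProduct.ext_threefold fun _ _ _ => rfl

theorem submodule_eq_top_of_left {W : Submodule ℂ ((X ⊗[ℂ] Y) ⊗[ℂ] Z)} {s : Set X}
    (hs : Submodule.span ℂ s = ⊤) (h : ∀ x ∈ s, ∀ y z, (x ⊗ₜ y) ⊗ₜ z ∈ W) : W = ⊤ := by
  have h1 : ∀ (x : X) (y : Y) (z : Z), (x ⊗ₜ y) ⊗ₜ z ∈ W := by
    intro x y z
    have hx : x ∈ Submodule.span ℂ s := hs ▸ Submodule.mem_top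
    induction hx using Submodule.span_induction with
    | mem x hx => exact h x hx y z
    | zero => simp
    | add a b _ _ ha hb => rw [TensorProduct.add_tmul, TensorProduct.add_tmul]; exact add_mem ha hb
    | smul c a _ ha =>
      rw [← TensorProduct.smul_tmul', ← TensorProduct.smul_tmul']; exact W.smul_mem c ha
  refine eq_top_iff.mpr fun t _ => ?_
  induction t using TensorProduct.induction_on with
  | zero => exact zero_mem _
  | add a b ha hb => exact add_mem (ha trivial) (hb trivial)
  | tmul p z =>
    induction p using TensorProduct.induction_on with
    | zero => simp
    | add a b ha hb =>
      rw [TensorProduct.add_tmul]; exact add_mem (ha trivial) (hb trivial)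
    | tmul x y => exact h1 x y z

theorem submodule_eq_top_of_middle {W : Submodule ℂ ((X ⊗[ℂ] Y) ⊗[ℂ] Z)} {s : Set Y}
    (hs : Submodule.span ℂ s = ⊤) (h : ∀ y ∈ s, ∀ x z, (x ⊗ₜ y) ⊗ₜ z ∈ W) : W = ⊤ := by
  refine submodule_eq_top_of_left (s := Set.univ) Submodule.span_univ fun x _ y z => ?_
  have hy : y ∈ Submodule.span ℂ s := hs ▸ Submodule.mem_top
  induction hy using Submodule.span_induction with
  | mem y hy => exact h y hy x z
  | zero => simp
  | add a b _ _ ha hb => rw [TensorProduct.tmul_add, TensorProduct.add_tmul]; exact add_mem ha hb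
  | smul c a _ ha =>
    rw [TensorProduct.tmul_smul, ← TensorProduct.smul_tmul']; exact W.smul_mem c ha

end Tensor

/-! ### The two triples on the product module. -/

section Product

variable (n₁ n₂ : ℕ) (l : ℚ) (ρ : ℂ)

/-- The spin of the first factor. -/
abbrev leftSpin : Triple (Module.End ℂ
    ((SpinSpace ((n₁ : ℚ) / 2) ⊗[ℂ] SpinSpace ((n₂ : ℚ) / 2)) ⊗[ℂ] Space l ρ)) :=
  (spinTriple ((n₁ : ℚ) / 2)).map (onLeft _ _ _)

/-- The spin of the second factor. -/
abbrev rightSpin : Triple (Module.End ℂ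
    ((SpinSpace ((n₁ : ℚ) / 2) ⊗[ℂ] SpinSpace ((n₂ : ℚ) / 2)) ⊗[ℂ] Space l ρ)) :=
  (spinTriple ((n₂ : ℚ) / 2)).map (onMiddle _ _ _)

/-- The combination `(J + εK) / 2` on the third factor. -/
abbrev thirdChiral (ε : ℂ) : Triple (Module.End ℂ
    ((SpinSpace ((n₁ : ℚ) / 2) ⊗[ℂ] SpinSpace ((n₂ : ℚ) / 2)) ⊗[ℂ] Space l ρ)) :=
  (chiral l ρ ε).map (onRight _ _ _)

variable {l ρ} in
theorem chiral_map {B : Type*} [Ring B] [Algebra ℂ B] (φ : Module.End ℂ (Space l ρ) →ₐ[ℂ] B)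
    (ε : ℂ) : (chiral l ρ ε).map φ =
      ⟨(1 / 2 : ℂ) • (φ (J₀ l ρ) + ε • φ (K₀ l ρ)),
        (1 / 2 : ℂ) • (φ (Jplus l ρ) + ε • φ (Kplus l ρ)),
        (1 / 2 : ℂ) • (φ (Jminus l ρ) + ε • φ (Kminus l ρ))⟩ := by
  simp only [chiral, Triple.map, map_smul, map_add]

/-- Because `K = -iJ` on `F⁻`, `(J + iK)/2` is `J` there and `(J - iK)/2` is `0`; on `F⁺` the roles
are exchanged. Each finite-dimensional factor therefore joins just one of the two triples. -/
theorem productAction_eq : productAction ((n₁ : ℚ) / 2) ((n₂ : ℚ) / 2) l ρ =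
    Action.ofTriples ((leftSpin n₁ n₂ l ρ).add (thirdChiral n₁ n₂ l ρ Complex.I))
      ((rightSpin n₁ n₂ l ρ).add (thirdChiral n₁ n₂ l ρ (-Complex.I))) := by
  have key : ∀ (f : Module.End ℂ (SpinSpace ((n₁ : ℚ) / 2)))
      (g : Module.End ℂ (SpinSpace ((n₂ : ℚ) / 2))) (k : Module.End ℂ (Space l ρ)),
      (f.rTensor _ + g.lTensor _).rTensor (Space l ρ) + k.lTensor _ =
        onLeft _ _ _ f + onMiddle _ _ _ g + onRight _ _ _ k := fun f g k => by
    rw [LinearMap.rTensor_add]; rfl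
  rw [productAction, finiteAction, Action.tensor, Action.tensor,
    thirdChiral, thirdChiral, chiral_map, chiral_map,
    Action.ofTriples_add]
  simp only [key]
  congr 1
  · funext a
    simp only [leftAction, rightAction, irrAction, spinJ, Triple.map]
    fin_cases a <;> simp only [ofLadder, Fin.zero_eta, Fin.mk_one, Fin.reduceFinMk,
      Matrix.cons_val_zero, Matrix.cons_val_one, Matrix.cons_val, map_smul, map_add, map_sub,
      spinTriple] <;> module
  · funext a
    simp only [leftAction, rightAction, irrAction, spinJ, Triple.map]
    fin_cases a <;> simp only [ofLadder, Fin.zero_eta, Fin.mk_one, Fin.reduceFinMk,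
      Matrix.cons_val_zero, Matrix.cons_val_one, Matrix.cons_val, map_smul, map_add, map_sub,
      spinTriple] <;> module

variable {n₁ n₂ l ρ} {N : ℕ}

theorem Unbounded.coupled_left (h : Unbounded l ρ) (hN : |l| = N / 2) :
    Triple.Coupled n₁ ((l : ℂ) - ρ) (leftSpin n₁ n₂ l ρ) (thirdChiral n₁ n₂ l ρ Complex.I) where
  left := isSl2_spinTriple.map _
  right := (h.isSl2_chiral hN Complex.I_mul_I).map _
  comm := Triple.commutes_map_map onLeft_mul_onRight _ _
  cas := by
    rw [Triple.casimir_map, h.casimir_chiral hN Complex.I_mul_I, map_smul, map_one]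
    congr 1
    linear_combination ((l : ℂ) * ρ / 2) * Complex.I_mul_I
  top y _ := by
    change (onLeft _ _ _ _ ^ (n₁ + 1)) y = 0
    rw [← map_pow, spin_e_pow_eq_zero, map_zero, LinearMap.zero_apply]
  span W hW := by
    refine submodule_eq_top_of_left
      (s := Set.range fun i => ((spinTriple ((n₁ : ℚ) / 2)).e ^ i) (spinWt n₁ 0))
      (spin_e_pow_span _ fun i => Submodule.subset_span ⟨i, rfl⟩) ?_
    rintro _ ⟨i, rfl⟩ y z
    have := hW ((spinWt n₁ 0 ⊗ₜ y) ⊗ₜ z) i ⟨?_, ?_⟩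
    · change (onLeft _ _ _ _ ^ i) _ ∈ W at this
      rwa [← map_pow, onLeft_apply] at this
    · change onLeft _ _ _ _ _ = 0
      rw [onLeft_apply, low_spinWt.1, TensorProduct.zero_tmul, TensorProduct.zero_tmul]
    · change onLeft _ _ _ _ _ = _
      rw [onLeft_apply, low_spinWt.2, TensorProduct.smul_tmul', TensorProduct.smul_tmul']

theorem Unbounded.coupled_right (h : Unbounded l ρ) (hN : |l| = N / 2) :
    Triple.Coupled n₂ ((l : ℂ) + ρ) (rightSpin n₁ n₂ l ρ)
      (thirdChiral n₁ n₂ l ρ (-Complex.I)) where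
  left := isSl2_spinTriple.map _
  right := (h.isSl2_chiral hN (by rw [neg_mul_neg, Complex.I_mul_I])).map _
  comm := Triple.commutes_map_map onMiddle_mul_onRight _ _
  cas := by
    rw [Triple.casimir_map, h.casimir_chiral hN (by rw [neg_mul_neg, Complex.I_mul_I]), map_smul,
      map_one]
    congr 1
    linear_combination (-(l : ℂ) * ρ / 2) * Complex.I_mul_I
  top y _ := by
    change (onMiddle _ _ _ _ ^ (n₂ + 1)) y = 0
    rw [← map_pow, spin_e_pow_eq_zero, map_zero, LinearMap.zero_apply]
  span W hW := by
    refine submodule_eq_top_of_middle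
      (s := Set.range fun i => ((spinTriple ((n₂ : ℚ) / 2)).e ^ i) (spinWt n₂ 0))
      (spin_e_pow_span _ fun i => Submodule.subset_span ⟨i, rfl⟩) ?_
    rintro _ ⟨i, rfl⟩ x z
    have := hW ((x ⊗ₜ spinWt n₂ 0) ⊗ₜ z) i ⟨?_, ?_⟩
    · change (onMiddle _ _ _ _ ^ i) _ ∈ W at this
      rwa [← map_pow, onMiddle_apply] at this
    · change onMiddle _ _ _ _ _ = 0
      rw [onMiddle_apply, low_spinWt.1, TensorProduct.tmul_zero, TensorProduct.zero_tmul]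
    · change onMiddle _ _ _ _ _ = _
      rw [onMiddle_apply, low_spinWt.2, TensorProduct.tmul_smul, ← TensorProduct.smul_tmul']

theorem Unbounded.commutes_total (h : Unbounded l ρ) (hN : |l| = N / 2) :
    ((leftSpin n₁ n₂ l ρ).add (thirdChiral n₁ n₂ l ρ Complex.I)).Commutes
      ((rightSpin n₁ n₂ l ρ).add (thirdChiral n₁ n₂ l ρ (-Complex.I))) :=
  ((Triple.commutes_map_map onLeft_mul_onMiddle _ _).add_right
      (Triple.commutes_map_map onLeft_mul_onRight _ _)).add_left
    ((Triple.commutes_map_map (fun x y => (onMiddle_mul_onRight y x).symm) _ _).add_right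
      ((h.commutes_chiral hN Complex.I_mul_I).map _))

/-- The leading-term argument is used twice on the tensor product `y` of lowest vectors. The right
polynomial `G` commutes with the left spin and with the left copy on `V`. So `G y` is still lowest
for the left spin, and `f^n₁ G y = G f^n₁ y`, to which the argument applies on the right. What must
not vanish in the end is `f^n₂ f^n₁ y`, with one `f` from each copy on `V`. -/
theorem Unbounded.omitted_factor_ne_zero (h : Unbounded l ρ) (hN : |l| = N / 2) (E F : ℕ → ℂ)
    {s t : Finset ℕ} (hs : s.card = n₁) (ht : t.card = n₂) :
    aeval ((leftSpin n₁ n₂ l ρ).add (thirdChiral n₁ n₂ l ρ Complex.I)).casimir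
        (∏ j ∈ s, (X - C (E j))) *
      aeval ((rightSpin n₁ n₂ l ρ).add (thirdChiral n₁ n₂ l ρ (-Complex.I))).casimir
        (∏ j ∈ t, (X - C (F j))) ≠ 0 := by
  have HL := h.coupled_left (n₁ := n₁) (n₂ := n₂) hN
  have HR := h.coupled_right (n₁ := n₁) (n₂ := n₂) hN
  set B := ((rightSpin n₁ n₂ l ρ).add (thirdChiral n₁ n₂ l ρ (-Complex.I))).casimir with hB
  set y : (SpinSpace ((n₁ : ℚ) / 2) ⊗[ℂ] SpinSpace ((n₂ : ℚ) / 2)) ⊗[ℂ] Space l ρ :=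
    (spinWt n₁ 0 ⊗ₜ spinWt n₂ 0) ⊗ₜ wt l ρ N 0 with hy
  have hc1 := ((Triple.commutes_map_map (fun x y => (onLeft_mul_onMiddle y x).symm)
    (spinTriple ((n₂ : ℚ) / 2)) (spinTriple ((n₁ : ℚ) / 2))).add_left
      (Triple.commutes_map_map (fun x y => (onLeft_mul_onRight y x).symm)
        (chiral l ρ (-Complex.I)) (spinTriple ((n₁ : ℚ) / 2)))).casimir_commute
  have hc0 : (thirdChiral n₁ n₂ l ρ (-Complex.I)).Commutes (thirdChiral n₁ n₂ l ρ Complex.I) :=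
    (h.commutes_chiral hN Complex.I_mul_I).symm.map _
  have hc2 := ((Triple.commutes_map_map
      (onMiddle_mul_onRight (X := SpinSpace ((n₁ : ℚ) / 2))) (spinTriple ((n₂ : ℚ) / 2))
      (chiral l ρ Complex.I)).add_left
    hc0).casimir_commute
  set G := aeval B (∏ j ∈ t, (X - C (F j))) with hG
  have hLow1 : (leftSpin n₁ n₂ l ρ).Low n₁ y := by
    constructor
    · change onLeft _ _ _ _ _ = 0
      rw [hy, onLeft_apply, low_spinWt.1, TensorProduct.zero_tmul, TensorProduct.zero_tmul]
    · change onLeft _ _ _ _ _ = _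
      rw [hy, onLeft_apply, low_spinWt.2, TensorProduct.smul_tmul', TensorProduct.smul_tmul']
  have hpow : ((thirdChiral n₁ n₂ l ρ Complex.I).f ^ n₁) y =
      (spinWt n₁ 0 ⊗ₜ spinWt n₂ 0) ⊗ₜ ((chiral l ρ Complex.I).f ^ n₁) (wt l ρ N 0) := by
    change (onRight _ _ _ _ ^ n₁) _ = _
    rw [← map_pow, hy, onRight_apply]
  have hLow2 : (rightSpin n₁ n₂ l ρ).Low n₂ (((thirdChiral n₁ n₂ l ρ Complex.I).f ^ n₁) y) := by
    rw [hpow]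
    constructor
    · change onMiddle _ _ _ _ _ = 0
      rw [onMiddle_apply, low_spinWt.1, TensorProduct.tmul_zero, TensorProduct.zero_tmul]
    · change onMiddle _ _ _ _ _ = _
      rw [onMiddle_apply, low_spinWt.2, TensorProduct.tmul_smul, ← TensorProduct.smul_tmul']
  have hne : ((thirdChiral n₁ n₂ l ρ (-Complex.I)).f ^ n₂)
      (((thirdChiral n₁ n₂ l ρ Complex.I).f ^ n₁) y) ≠ 0 := by
    rw [hpow]
    change (onRight _ _ _ _ ^ n₂) _ ≠ 0
    rw [← map_pow, onRight_apply]
    refine tmul_ne_zero (tmul_ne_zero spinWt_zero_ne_zero spinWt_zero_ne_zero) ?_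
    obtain ⟨c, hc, e⟩ := h.chiral_f_pow_wt_zero hN Complex.I_ne_zero n₁ 0
    obtain ⟨c', hc', e'⟩ := h.chiral_f_pow_wt_zero hN (neg_ne_zero.mpr Complex.I_ne_zero) n₂ (0 + n₁)
    rw [Nat.cast_zero, mul_zero, add_zero] at e
    rw [e, map_smul, e']
    exact smul_ne_zero hc (smul_ne_zero hc' (h.wt_zero_ne_zero hN _))
  have hLowG : (leftSpin n₁ n₂ l ρ).Low n₁ (G y) := by
    constructor
    · rw [← Module.End.mul_apply, ← (Triple.commute_aeval hc1.2.2 _).eq, Module.End.mul_apply,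
        hLow1.1, map_zero]
    · rw [← Module.End.mul_apply, ← (Triple.commute_aeval hc1.1 _).eq, Module.End.mul_apply,
        hLow1.2, map_smul]
  have hGne := HR.prod_ne_zero hLow2 F ht.le (by rw [ht]; exact hne)
  have hcG : Commute G (thirdChiral n₁ n₂ l ρ Complex.I).f := Triple.commute_aeval hc2.2.2 _
  have hfin := HL.prod_ne_zero hLowG E hs.le (by
    rw [hs, ← Module.End.mul_apply, ← (hcG.pow_right n₁).eq, Module.End.mul_apply]
    exact hGne)
  intro h0
  rw [← Module.End.mul_apply, h0] at hfin
  exact hfin rfl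

end Product

/-! ### Repeated roots and the labels of the eigenvalues. -/

open Triple in
theorem level_injOn_iff (n : ℕ) (a : ℂ) :
    Set.InjOn (Coupled.level n a) (Finset.range (n + 1)) ↔ a ∉ integersWithin n := by
  constructor
  · rintro h ⟨z, rfl, h1, h2⟩
    have h1' : -(n : ℤ) < z := by exact_mod_cast h1
    have h2' : z < (n : ℤ) := by exact_mod_cast h2
    have key : ∀ k m : ℕ, k ≤ n → m ≤ n → (k : ℤ) + m = z + n → k = m := fun k m hk hm e => by
      refine h (by simpa using Nat.lt_succ_of_le hk) (by simpa using Nat.lt_succ_of_le hm) ?_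
      have e' : (k : ℂ) + m = z + n := by exact_mod_cast e
      rw [Coupled.level, Coupled.level]
      linear_combination (k - m : ℂ) * e'
    -- Two distinct indices with sum `z + n` are needed: `0` and `z + n` if `z ≤ 0`, otherwise `n`
    -- and `z`.
    rcases le_or_gt (z + n) n with hz | hz
    · have := key 0 (z + n).toNat (by omega) (by omega) (by omega)
      omega
    · have := key n z.toNat le_rfl (by omega) (by omega)
      omega
  · intro h k hk m hm e
    by_contra hkm
    have hk' : k ≤ n := by simpa [Nat.lt_succ_iff] using hk
    have hm' : m ≤ n := by simpa [Nat.lt_succ_iff] using hm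
    rw [Coupled.level, Coupled.level] at e
    have e1 : ((k : ℂ) - m) * (a - (k + m - n)) = 0 := by linear_combination (-1 : ℂ) * e
    have e2 : (k : ℂ) - m ≠ 0 := sub_ne_zero.mpr (by exact_mod_cast hkm)
    refine h ⟨(k : ℤ) + m - n, ?_, ?_, ?_⟩
    · push_cast
      exact sub_eq_zero.mp ((mul_eq_zero.mp e1).resolve_left e2)
    · push_cast
      have : (0 : ℚ) < k + m := by exact_mod_cast (by omega : 0 < k + m)
      linarith
    · push_cast
      have : (k : ℚ) + m < n + n := by exact_mod_cast (by omega : k + m < n + n)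
      linarith

theorem neg_mem_integersWithin {a : ℚ} {z : ℂ} (h : z ∈ integersWithin a) :
    -z ∈ integersWithin a := by
  obtain ⟨n, rfl, h1, h2⟩ := h
  exact ⟨-n, by push_cast; rfl, by push_cast; linarith, by push_cast; linarith⟩

theorem neg_mem_integersWithin_iff {a : ℚ} {z : ℂ} :
    -z ∈ integersWithin a ↔ z ∈ integersWithin a :=
  ⟨fun h => by simpa using neg_mem_integersWithin h, neg_mem_integersWithin⟩

theorem mem_magnetic_half_iff_sub {n : ℕ} {ν : ℚ} :
    ν ∈ magnetic ((n : ℚ) / 2) ↔ ∃ k ∈ Finset.range (n + 1), ν = n / 2 - k := by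
  constructor
  · rintro ⟨m, rfl, hm⟩
    have : (m : ℚ) ≤ n := by linarith
    have hm' : m ≤ n := by exact_mod_cast this
    exact ⟨n - m, by simp, by push_cast [Nat.cast_sub hm']; ring⟩
  · rintro ⟨k, hk, rfl⟩
    have hk' : k ≤ n := by simpa [Nat.lt_succ_iff] using hk
    exact ⟨n - k, by push_cast [Nat.cast_sub hk']; ring,
      by have : (0 : ℚ) ≤ k := k.cast_nonneg
         linarith⟩

section Product

open Triple

variable {n₁ n₂ N : ℕ} {l : ℚ} {ρ : ℂ} (h : Unbounded l ρ) (hN : |l| = N / 2)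
include h hN

theorem Unbounded.simultaneouslyDiagonalisable_iff :
    SimultaneouslyDiagonalisable (productAction (n₁ / 2) (n₂ / 2) l ρ).casimir₁
        (productAction (n₁ / 2) (n₂ / 2) l ρ).casimir₂ ↔
      ρ - (l : ℂ) ∉ integersWithin n₁ ∧ ρ + (l : ℂ) ∉ integersWithin n₂ := by
  have HL := h.coupled_left (n₁ := n₁) (n₂ := n₂) hN
  have HR := h.coupled_right (n₁ := n₁) (n₂ := n₂) hN
  have hc := h.commutes_total (n₁ := n₁) (n₂ := n₂) hN
  rw [productAction_eq, simultaneouslyDiagonalisable_ofTriples_iff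
    (HL.left.add HL.right HL.comm) (HR.left.add HR.right HR.comm) hc,
    simultaneouslyDiagonalisable_iff_injOn HL.aeval_levelPoly HR.aeval_levelPoly hc.commute_casimir
      (fun k hk m hm => h.omitted_factor_ne_zero hN _ _ (by simp [Finset.card_erase_of_mem hk])
        (by simp [Finset.card_erase_of_mem hm])) ⟨0, by simp⟩ ⟨0, by simp⟩,
    -- The left parameter is `λ - ρ`; the interval is symmetric, so the sign does not matter.
    level_injOn_iff, level_injOn_iff, ← neg_mem_integersWithin_iff, neg_sub, add_comm]

theorem Unbounded.jointEigenvalues_productAction :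
    jointEigenvalues (productAction (n₁ / 2) (n₂ / 2) l ρ).casimir₁
        (productAction (n₁ / 2) (n₂ / 2) l ρ).casimir₂ =
      shiftedPair l ρ '' (magnetic (n₁ / 2) ×ˢ magnetic (n₂ / 2)) := by
  have HL := h.coupled_left (n₁ := n₁) (n₂ := n₂) hN
  have HR := h.coupled_right (n₁ := n₁) (n₂ := n₂) hN
  have hc := h.commutes_total (n₁ := n₁) (n₂ := n₂) hN
  have e := Complex.I_mul_I
  ext ⟨c₁, c₂⟩
  rw [productAction_eq, mem_jointEigenvalues_ofTriples_iff
    (HL.left.add HL.right HL.comm) (HR.left.add HR.right HR.comm) hc,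
    jointEigenvalues_eq HL.aeval_levelPoly HR.aeval_levelPoly hc.commute_casimir
      (fun k hk m hm => h.omitted_factor_ne_zero hN _ _ (by simp [Finset.card_erase_of_mem hk])
        (by simp [Finset.card_erase_of_mem hm]))]
  constructor
  · rintro ⟨⟨k, m⟩, ⟨hk, hm⟩, hkm⟩
    obtain ⟨e1, e2⟩ := Prod.mk.inj hkm
    -- With `ν = n/2 - k`, the root is built from `a + n - 2k = a + 2ν`; for the two triples this is
    -- `Λ - Ρ` and `Λ + Ρ`.
    refine ⟨(n₁ / 2 - k, n₂ / 2 - m), ⟨mem_magnetic_half_iff_sub.mpr ⟨k, hk, rfl⟩,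
      mem_magnetic_half_iff_sub.mpr ⟨m, hm, rfl⟩⟩, Prod.ext ?_ ?_⟩
    · simp only [shiftedPair, casimirPair, Coupled.level] at e1 e2 ⊢
      push_cast
      linear_combination (-Complex.I) * e1 + Complex.I * e2 - c₁ * e
    · simp only [shiftedPair, casimirPair, Coupled.level] at e1 e2 ⊢
      push_cast
      linear_combination 2 * e1 + 2 * e2
  · rintro ⟨⟨ν₁, ν₂⟩, ⟨h1, h2⟩, hν⟩
    obtain ⟨k, hk, e1⟩ := mem_magnetic_half_iff_sub.mp h1
    obtain ⟨m, hm, e2⟩ := mem_magnetic_half_iff_sub.mp h2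
    simp only at e1 e2
    obtain ⟨e3, e4⟩ := Prod.mk.inj hν
    subst e1 e2
    refine ⟨(k, m), ⟨hk, hm⟩, Prod.ext ?_ ?_⟩
    · simp only [Coupled.level]
      push_cast at e3 e4
      linear_combination (Complex.I / 2) * e3 + (1 / 4) * e4
        - (1 / 2) * (l + (n₁ / 2 - k) + (n₂ / 2 - m)) * (ρ - (n₁ / 2 - k) + (n₂ / 2 - m)) * e
    · simp only [Coupled.level]
      push_cast at e3 e4
      linear_combination (-Complex.I / 2) * e3 + (1 / 4) * e4
        + (1 / 2) * (l + (n₁ / 2 - k) + (n₂ / 2 - m)) * (ρ - (n₁ / 2 - k) + (n₂ / 2 - m)) * e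

end Product

/-- For `λ = ρ = 0` the square of `P⁻(j)` times `(4j² - 1) j²` is `j⁴`, nonzero at every `j = k +
1`. -/
theorem unbounded_zero : Unbounded 0 0 := by
  intro k h0
  rw [Pplus] at h0
  have hk : (0 : ℚ) ≤ k := k.cast_nonneg
  have := Pminus_sq (l := 0) (ρ := 0) (j := |0| + k + 1) (by simp; linarith) (by simp)
  rw [h0] at this
  simp at this
  exact Nat.cast_add_one_ne_zero k this

end Lorentz

end

theorem mainTheorem4 :
    (∀ (γ₁ γ₂ l : ℚ) (ρ : ℂ),
      (∃ n : ℕ, γ₁ = n / 2) → 1 / 2 ≤ γ₁ →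
      (∃ n : ℕ, γ₂ = n / 2) → 1 / 2 ≤ γ₂ →
      (∃ k : ℤ, l = k / 2) →
      ¬ FiniteDimensional ℂ (Lorentz.Space l ρ) →
      (Lorentz.SimultaneouslyDiagonalisable
          (Lorentz.productAction γ₁ γ₂ l ρ).casimir₁ (Lorentz.productAction γ₁ γ₂ l ρ).casimir₂ ↔
        ρ - (l : ℂ) ∉ Lorentz.integersWithin (2 * γ₁) ∧
          ρ + (l : ℂ) ∉ Lorentz.integersWithin (2 * γ₂)) ∧
      Lorentz.jointEigenvalues
          (Lorentz.productAction γ₁ γ₂ l ρ).casimir₁ (Lorentz.productAction γ₁ γ₂ l ρ).casimir₂ =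
        Lorentz.shiftedPair l ρ '' (Lorentz.magnetic γ₁ ×ˢ Lorentz.magnetic γ₂)) ∧
    (∃ (γ₁ γ₂ l : ℚ) (ρ : ℂ),
      (∃ n : ℕ, γ₁ = n / 2) ∧ 1 / 2 ≤ γ₁ ∧
      (∃ n : ℕ, γ₂ = n / 2) ∧ 1 / 2 ≤ γ₂ ∧
      (∃ k : ℤ, l = k / 2) ∧
      ¬ FiniteDimensional ℂ (Lorentz.Space l ρ) ∧
      ¬ Set.InjOn (Lorentz.shiftedPair l ρ) (Lorentz.magnetic γ₁ ×ˢ Lorentz.magnetic γ₂)) := by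
  refine ⟨?_, ?_⟩
  · rintro _ _ l ρ ⟨n₁, rfl⟩ - ⟨n₂, rfl⟩ - ⟨k, hk⟩ hinf
    have h := Lorentz.unbounded_of_not_finiteDimensional hinf
    have hN : |l| = (k.natAbs : ℚ) / 2 := by
      rw [hk, abs_div, Nat.cast_natAbs, Int.cast_abs, abs_two]
    rw [mul_div_cancel₀ _ two_ne_zero, mul_div_cancel₀ _ two_ne_zero]
    exact ⟨h.simultaneouslyDiagonalisable_iff hN, h.jointEigenvalues_productAction hN⟩
  -- With `λ = ρ = 0`, the choices `(1/2, 1/2)` and `(-1/2, -1/2)` give `(Λ, Ρ) = (± 1, 0)`, and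
  -- both yield the pair `(0, 0)`.
  · refine ⟨1 / 2, 1 / 2, 0, 0, ⟨1, by norm_num⟩, le_rfl, ⟨1, by norm_num⟩, le_rfl, ⟨0, by norm_num⟩,
      Lorentz.unbounded_zero.not_finiteDimensional, fun h => ?_⟩
    have h1 : (1 / 2 : ℚ) ∈ Lorentz.magnetic (1 / 2) := ⟨1, by norm_num, le_rfl⟩
    have h2 : (-(1 / 2) : ℚ) ∈ Lorentz.magnetic (1 / 2) := ⟨0, by norm_num, by norm_num⟩
    have := @h (1 / 2, 1 / 2) ⟨h1, h1⟩ (-(1 / 2), -(1 / 2)) ⟨h2, h2⟩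
      (by simp only [Lorentz.shiftedPair, Lorentz.casimirPair]; push_cast; norm_num)
    have := congrArg Prod.fst this
    norm_num at this
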